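/- Let $n\in\mathbb N$, $\gamma\in(0,1)$, $T>0$, $\tau>0$, $s>0$, and write $L^2=L^2(\mathbb{R}^n)$, $H^2=H^2(\mathbb{R}^n)$. Let $\varphi$ be the kernel whose Fourier transform, in the normalization $\widehat f(\xi)=(2\pi)^{-n/2}\int_{\mathbb{R}^n} f(x)e^{-ix\cdot\xi}\,dx$, is $\widehat\varphi(\xi)=(2\pi)^{-n/2}\exp(-\tau|\xi|^s)$, i.e. $\varphi(x)=(2\pi)^{-n}\int_{\mathbb{R}^n} e^{-\tau|\xi|^s}e^{ix\cdot\xi}\,d\xi$. For $\alpha>0$ put $\varphi_\alpha(x)=\alpha^{-n}\varphi(x/\alpha)$ and $M_\alpha f=\varphi_\alpha\star f$ for $f\in L^2$. For a function $h$ on $\mathbb{R}^n$, a (weak) solution with final data $h$ is a function $u\in C([0,T],L^2)\cap C((0,T],H^2)$ such that $\frac{\partial^\gamma u}{\partial t^\gamma}=\Delta u$ holds in $L^2$ for every $t\in(0,T)$ and $u(\cdot,T)=h$ (equivalently, $\|u(\cdot,t)-h\|_{H^2}\to 0$ as $t\to T$). Here $\frac{\partial^\gamma u}{\partial t^\gamma}(t)=\frac1{\Gamma(1-\gamma)}\int_0^t\frac{u'(r)}{(t-r)^\gamma}\,dr$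 is the Caputo derivative, $u'$ being the $L^2$-valued derivative and the integral being understood as the limit in $L^2$ of the integrals over $(\varepsilon,t)$ as $\varepsilon\downarrow0$. Then the solutions with mollified final data form a regularization method for the problem of recovering $u(\cdot,t)$, $t\in[0,T]$, from $g=u(\cdot,T)$. That is: 1. For every $\alpha>0$ and $g\in L^2$ there is a unique solution $u_\alpha$ with final data $M_\alpha g$, and for every $t\in[0,T]$ the map $R_{\alpha,t}:g\mapsto u_\alpha(\cdot,t)$ is a bounded linear operator on $L^2$. 2. There are constants $C>0$ and $\alpha_0>0$ (independent of $\alpha$ and $t$) such that $\|R_{\alpha,t}\|_{L^2\to L^2}\le C/\alpha^2$ for all $\alpha\in(0,\alpha_0)$ and all $t\in[0,T]$. 3. If $u$ is a solution with final data $g$, then for every $t\in[0,T]$, $u_\alpha(\cdot,t)=R_{\alpha,t}\,g\to u(\cdot,t)$ in $L^2$ as $\alpha\downarrow0$. -/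

import Mathlib

open Set Filter Topology MeasureTheory
open scoped ENNReal SchwartzMap FourierTransform Laplacian

noncomputable section

namespace FracDiffusion

/-- The space `L²(ℝⁿ)` of complex-valued functions. -/
abbrev L2 (n : ℕ) : Type := Lp (α := EuclideanSpace ℝ (Fin n)) ℂ 2 volume

/-- The unitary inverse Fourier transform
`(𝓕⁻¹ f)(x) = (2π)^{-n/2} ∫ f(ξ) e^{i x·ξ} dξ` of an integrable function. -/
def unitaryFourierInv (n : ℕ) (f : EuclideanSpace ℝ (Fin n) → ℂ)
    (x : EuclideanSpace ℝ (Fin n)) : ℂ :=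
  ((Real.sqrt (2 * Real.pi) : ℂ) ^ n)⁻¹ *
    ∫ ξ, f ξ * Complex.exp (Complex.I * (inner ℝ x ξ : ℝ))

/-- The mollifier kernel `φ = (2π)^{-n/2} 𝓕⁻¹ (exp (-τ |ξ|^s))`, that is, the function with
unitary Fourier transform `(2π)^{-n/2} exp (-τ |ξ|^s)`. -/
def kernel (n : ℕ) (τ s : ℝ) (x : EuclideanSpace ℝ (Fin n)) : ℂ :=
  ((Real.sqrt (2 * Real.pi) : ℂ) ^ n)⁻¹ *
    unitaryFourierInv n (fun ξ => (Real.exp (-τ * ‖ξ‖ ^ s) : ℂ)) x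

/-- The rescaled kernel `φ_α(x) = α^{-n} φ(x / α)`. -/
def scaledKernel (n : ℕ) (τ s α : ℝ) (x : EuclideanSpace ℝ (Fin n)) : ℂ :=
  ((α : ℂ) ^ n)⁻¹ * kernel n τ s (α⁻¹ • x)

/-- The mollifier operator `(M_α f)(x) = (φ_α ⋆ f)(x) = ∫ φ_α(x - y) f(y) dy`. -/
def mollify (n : ℕ) (τ s α : ℝ) (f : L2 n) (x : EuclideanSpace ℝ (Fin n)) : ℂ :=
  ∫ y, scaledKernel n τ s α (x - y) * f y

/-- The norm of `H^p(ℝⁿ)`, as an extended nonnegative number (`∞` off `H^p`). In the unitary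
normalisation of the Fourier transform it is `‖(1 + |ξ|²)^{p/2} f̂(ξ)‖_{L²}`. Mathlib's `𝓕` uses
the character `e^{-2πi x·η}`, whence the substitution `ξ = 2πη`. -/
def sobolevNorm (n : ℕ) (p : ℝ) (f : L2 n) : ℝ≥0∞ :=
  eLpNorm (fun η : EuclideanSpace ℝ (Fin n) =>
    (((1 + (2 * Real.pi * ‖η‖) ^ 2) ^ (p / 2) : ℝ) : ℂ) * (𝓕 f : L2 n) η) 2 volume

/-- `D` is the Caputo derivative of order `γ` at time `t` of the curve `u` in a Banach space:
`D = Γ(1-γ)⁻¹ ∫₀ᵗ (t-r)^{-γ} u'(r) dr`. Here `u'` is the norm derivative of `u`; as it may be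
singular at `r = 0`, the integral is the limit of the Bochner integrals over `(ε, t)` as
`ε ↓ 0` (this is the usual integral whenever the integrand is integrable on `(0, t)`). -/
def HasCaputoDerivAt {E : Type*} [NormedAddCommGroup E] [NormedSpace ℝ E]
    (γ : ℝ) (u : ℝ → E) (D : E) (t : ℝ) : Prop :=
  (∀ r ∈ Ioo 0 t, DifferentiableAt ℝ u r) ∧
  (∀ ε ∈ Ioo 0 t,
    IntervalIntegrable (fun r => (t - r) ^ (-γ) • deriv u r) volume ε t) ∧
  Tendsto (fun ε => (Real.Gamma (1 - γ))⁻¹ • ∫ r in ε..t, (t - r) ^ (-γ) • deriv u r)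
    (𝓝[>] 0) (𝓝 D)

/-- `u` is a weak solution of `∂^γ u / ∂t^γ = Δ u` on `ℝⁿ × (0, T)` with final value
`u(·, T) = g`: it belongs to `C([0,T], L²) ∩ C((0,T], H²)`, the equation holds in `L²` for every
`t ∈ (0,T)` (the distributional Laplacian of `u(·,t)` is the `L²` function which is the Caputo
derivative at `t`), and `u(·,T) = g`. By continuity in `H²` on `(0,T]`, the last condition says
`‖u(·,t) - g‖_{H²} → 0` as `t → T`. -/
structure IsWeakSolution (n : ℕ) (γ T : ℝ) (g : EuclideanSpace ℝ (Fin n) → ℂ)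
    (u : ℝ → L2 n) : Prop where
  continuousOn_L2 : ContinuousOn u (Icc 0 T)
  mem_H2 : ∀ t ∈ Ioc 0 T,
    TemperedDistribution.MemSobolev 2 2 (u t : 𝓢'(EuclideanSpace ℝ (Fin n), ℂ))
  continuousOn_H2 : ∀ t ∈ Ioc 0 T,
    Tendsto (fun r => sobolevNorm n 2 (u r - u t)) (𝓝[Ioc 0 T] t) (𝓝 0)
  equation : ∀ t ∈ Ioo 0 T, ∃ D : L2 n, HasCaputoDerivAt γ u D t ∧
    (D : 𝓢'(EuclideanSpace ℝ (Fin n), ℂ)) = Δ (u t : 𝓢'(EuclideanSpace ℝ (Fin n), ℂ))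
  final_value : u T =ᵐ[volume] g

end FracDiffusion

end

noncomputable section

namespace FracDiffusion

/-! ### Euler's beta integral and the Mittag-Leffler series -/

/-! On the Fourier side the equation decouples into the scalar problems `∂^γ y = -μ y` with `μ =
|ξ|²`, solved by `y(t) = E_γ(-μ t^γ) y(0)`, where `E_γ` is the Mittag-Leffler function (`relax`).
Final data `M_α g` therefore force the initial value with transform `exp(-τ|αξ|^s) ĝ(ξ) / E_γ(-μ
T^γ)`, and everything depends on how small the denominator can be.

Two bounds carry the estimates: `0 < E_γ(-μ t^γ) ≤ 1`, so the forward evolution is a contraction,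
and `1 ≤ E_γ(-μ T^γ) (1 + Γ(1-γ) μ T^γ)` (`one_le_relax_mul`), so going backwards costs only a
factor quadratic in `|ξ|`. The mollifier pays for it: with `x = α|ξ|`, `(1 + κ|ξ|²) exp(-τ x^s) ≤
C/α²` (`exists_initSymb_le`). Both bounds follow from monotonicity of `relax` (`antitoneOn_relax`),
which is proved by a maximum principle for the Caputo derivative, without complete monotonicity.

Existence holds because the mollifier beats every power of `|ξ|`: the initial value lies in the
domain of every weight needed, and derivative, Caputo integral and `H²` continuity pass to `L²` by
dominated convergence and Fubini.

For uniqueness, any solution is restricted to a ball of frequencies, where the Laplacian is bounded.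
The difference with the explicit solution vanishes at `0` and solves a linear fractional equation
with bounded operator; Abel inversion turns that into a Volterra equation, whose iteration gives
zero (`eq_zero_of_caputo_linear`). Hence every solution satisfies `û(t) = E_γ(-μ t^γ) û(0)`
(`IsWeakSolution.fourier_eq`).

For convergence, if `g = u(T)`, then `ĝ` is the denominator times `û(0)`; the division cancels and
the regularized solution is the true one multiplied by `exp(-τ|αξ|^s)`, which tends to `1`
boundedly. -/

theorem integral_sub_rpow_mul_rpow {a b t : ℝ} (ha : 0 < a) (hb : 0 < b) (ht : 0 < t) :
    ∫ r in (0 : ℝ)..t, (t - r) ^ (a - 1) * r ^ (b - 1) =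
      t ^ (a + b - 1) * (Real.Gamma a * Real.Gamma b / Real.Gamma (a + b)) := by
  have h := Complex.betaIntegral_scaled b a ht
  rw [Complex.betaIntegral_eq_Gamma_mul_div _ _ (by simpa using hb) (by simpa using ha)] at h
  have h2 : ∫ r in (0 : ℝ)..t, (r : ℂ) ^ ((b : ℂ) - 1) * ((t : ℂ) - r) ^ ((a : ℂ) - 1) =
      ((∫ r in (0 : ℝ)..t, (t - r) ^ (a - 1) * r ^ (b - 1) : ℝ) : ℂ) := by
    rw [← intervalIntegral.integral_ofReal]
    refine intervalIntegral.integral_congr fun r hr => ?_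
    rw [uIcc_of_le ht.le] at hr
    push_cast
    rw [Complex.ofReal_cpow hr.1, Complex.ofReal_cpow (sub_nonneg.2 hr.2)]
    push_cast
    ring
  rw [h2] at h
  have h3 : ((t : ℂ) ^ ((b : ℂ) + a - 1) = ((t ^ (a + b - 1) : ℝ) : ℂ)) := by
    rw [Complex.ofReal_cpow ht.le]; push_cast; ring_nf
  rw [h3, Complex.Gamma_ofReal, Complex.Gamma_ofReal, ← Complex.ofReal_add,
    Complex.Gamma_ofReal] at h
  have h4 : (∫ r in (0 : ℝ)..t, (t - r) ^ (a - 1) * r ^ (b - 1)) =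
      t ^ (a + b - 1) * (Real.Gamma b * Real.Gamma a / Real.Gamma (b + a)) := by
    exact_mod_cast h
  rw [h4, add_comm b a, mul_comm (Real.Gamma b)]

/-- The integral of a non-integrable function is `0` by convention, whereas the beta value is
positive. -/
theorem intervalIntegrable_sub_rpow_mul_rpow {a b t : ℝ} (ha : 0 < a) (hb : 0 < b) (ht : 0 < t) :
    IntervalIntegrable (fun r => (t - r) ^ (a - 1) * r ^ (b - 1)) volume 0 t := by
  by_contra h
  have h0 := intervalIntegral.integral_undef h
  rw [integral_sub_rpow_mul_rpow ha hb ht] at h0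
  have := Real.Gamma_pos_of_pos ha
  have := Real.Gamma_pos_of_pos hb
  have := Real.Gamma_pos_of_pos (add_pos ha hb)
  exact absurd h0 (by positivity)

/-- Write `exp(-R)` as the integral of `exp(-t)` over `t > R` and use `R^x ≤ t^x` there. This bound
serves twice: for the growth of `Γ` in the Mittag-Leffler series, and for exponential against
polynomial in the mollifier. -/
theorem rpow_mul_exp_neg_le_Gamma {R x : ℝ} (hR : 0 < R) (hx : 0 ≤ x) :
    R ^ x * Real.exp (-R) ≤ Real.Gamma (x + 1) := by
  have hx1 : 0 < x + 1 := by linarith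
  rw [Real.Gamma_eq_integral hx1, ← integral_exp_neg_Ioi, ← integral_const_mul]
  have hint := Real.GammaIntegral_convergent hx1
  calc ∫ t in Ioi R, R ^ x * Real.exp (-t)
      ≤ ∫ t in Ioi R, Real.exp (-t) * t ^ (x + 1 - 1) := by
        refine setIntegral_mono_on ?_ (hint.mono_set (Ioi_subset_Ioi hR.le)) measurableSet_Ioi ?_
        · exact (integrableOn_exp_neg_Ioi R).const_mul _
        · intro t ht
          rw [mul_comm, add_sub_cancel_right]
          gcongr
          exact le_of_lt ht
    _ ≤ _ := by
        refine setIntegral_mono_set hint ?_ (Ioi_subset_Ioi hR.le).eventuallyLE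
        filter_upwards [ae_restrict_mem measurableSet_Ioi] with t ht
        have : (0 : ℝ) < t := ht
        positivity

theorem summable_mittagLeffler {γ b : ℝ} (hγ : 0 < γ) (hb : 0 < b) (z : ℝ) :
    Summable fun k : ℕ => z ^ k / Real.Gamma (γ * k + b) := by
  obtain ⟨R, hR, hzR⟩ : ∃ R : ℝ, 0 < R ∧ |z| < R ^ γ := by
    -- Since `1/Γ(x) = x/Γ(x+1) ≤ x exp(R) R^(-x)`, a radius with `R^γ > |z|` makes the series
    -- geometric up to a linear factor.
    refine ⟨(|z| + 1) ^ γ⁻¹, by positivity, ?_⟩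
    rw [← Real.rpow_mul (by positivity), inv_mul_cancel₀ hγ.ne', Real.rpow_one]
    linarith
  have hq : ‖|z| / R ^ γ‖ < 1 := by
    rw [Real.norm_of_nonneg (by positivity), div_lt_one (by positivity)]
    exact hzR
  have hs : Summable fun k : ℕ =>
      Real.exp R * R ^ (-b) * (γ * ((k : ℝ) ^ 1 * (|z| / R ^ γ) ^ k) + b * (|z| / R ^ γ) ^ k) :=
    (((summable_pow_mul_geometric_of_norm_lt_one 1 hq).mul_left γ).add
      ((summable_geometric_of_norm_lt_one hq).mul_left b)).mul_left _
  refine Summable.of_norm_bounded hs fun k => ?_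
  have hx : 0 < γ * k + b := by positivity
  have h1 := rpow_mul_exp_neg_le_Gamma hR hx.le
  rw [Real.Gamma_add_one hx.ne'] at h1
  have hG := Real.Gamma_pos_of_pos hx
  rw [norm_div, norm_pow, Real.norm_of_nonneg hG.le, Real.norm_eq_abs, div_le_iff₀ hG]
  have h2 : R ^ (γ * k + b) = (R ^ γ) ^ k * R ^ b := by
    rw [Real.rpow_add hR, Real.rpow_mul hR.le, Real.rpow_natCast]
  rw [h2, Real.exp_neg] at h1
  have h3 : |z| ^ k = |z| ^ k / ((R ^ γ) ^ k) * R ^ (-b) * Real.exp R *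
      ((R ^ γ) ^ k * R ^ b * (Real.exp R)⁻¹) := by
    rw [Real.rpow_neg hR.le]
    field_simp
  calc |z| ^ k = _ := h3
    _ ≤ |z| ^ k / ((R ^ γ) ^ k) * R ^ (-b) * Real.exp R *
      ((γ * k + b) * Real.Gamma (γ * k + b)) := by gcongr
    _ = _ := by rw [div_pow]; ring

/-- The two-parameter Mittag-Leffler function `E_{γ,b}`. -/
def mittagLeffler (γ b z : ℝ) : ℝ := ∑' k : ℕ, z ^ k / Real.Gamma (γ * k + b)

theorem continuous_mittagLeffler {γ b : ℝ} (hγ : 0 < γ) (hb : 0 < b) :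
    Continuous (mittagLeffler γ b) := by
  rw [continuous_iff_continuousAt]
  intro z
  have hon : ContinuousOn (mittagLeffler γ b) (Metric.ball 0 (|z| + 1)) := by
    refine continuousOn_tsum (fun k => by fun_prop) (summable_mittagLeffler hγ hb (|z| + 1)) ?_
    intro k x hx
    have hG : 0 < Real.Gamma (γ * k + b) := Real.Gamma_pos_of_pos (by positivity)
    rw [norm_div, norm_pow, Real.norm_of_nonneg hG.le]
    gcongr
    exact (mem_ball_zero_iff.1 hx).le
  exact hon.continuousAt (Metric.isOpen_ball.mem_nhds (by simp))

/-- The function `t ^ (b - 1) * E_{γ,b}(-μ t ^ γ)`. -/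
def mlFun (γ μ b t : ℝ) : ℝ := t ^ (b - 1) * mittagLeffler γ b (-μ * t ^ γ)

theorem hasSum_mlFun {γ b t : ℝ} (hγ : 0 < γ) (hb : 0 < b) (μ : ℝ) (ht : 0 < t) :
    HasSum (fun k : ℕ => (-μ) ^ k * t ^ (γ * k + b - 1) / Real.Gamma (γ * k + b))
      (mlFun γ μ b t) := by
  have h := (summable_mittagLeffler hγ hb (-μ * t ^ γ)).hasSum.mul_left (t ^ (b - 1))
  refine h.congr_fun ?_
  intro k
  have : t ^ (γ * k + b - 1) = t ^ (b - 1) * (t ^ γ) ^ k := by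
    rw [add_sub_assoc, Real.rpow_add ht, Real.rpow_mul ht.le, Real.rpow_natCast]; ring
  rw [this, mul_pow]
  ring

theorem continuousOn_mlFun {γ b : ℝ} (hγ : 0 < γ) (hb : 0 < b) (μ : ℝ) :
    ContinuousOn (mlFun γ μ b) (Ioi 0) := by
  refine ContinuousOn.mul (fun t ht => ?_) ?_
  · exact (Real.continuousAt_rpow_const _ _ (Or.inl (ne_of_gt ht))).continuousWithinAt
  · refine (continuous_mittagLeffler hγ hb).comp_continuousOn (Continuous.continuousOn ?_)
    exact continuous_const.mul (Real.continuous_rpow_const hγ.le)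

/-- Fractional integration of order `a` sends `r^(γk+b-1)/Γ(γk+b)` to `t^(γk+a+b-1)/Γ(γk+a+b)`, by
the beta integral; the series may be integrated term by term. This one rule yields the derivative,
the Caputo equation and the kernel bound below. -/
theorem intervalIntegrable_and_integral_mlFun {γ a b t : ℝ} (hγ : 0 < γ) (ha : 0 < a) (hb : 0 < b)
    (μ : ℝ) (ht : 0 < t) :
    IntervalIntegrable (fun r => (t - r) ^ (a - 1) * mlFun γ μ b r) volume 0 t ∧
      ∫ r in (0 : ℝ)..t, (t - r) ^ (a - 1) * mlFun γ μ b r =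
        Real.Gamma a * mlFun γ μ (a + b) t := by
  set F : ℕ → ℝ → ℝ := fun k r =>
    ((-μ) ^ k / Real.Gamma (γ * k + b)) * ((t - r) ^ (a - 1) * r ^ (γ * k + b - 1)) with hF
  have hbk : ∀ k : ℕ, 0 < γ * k + b := fun k => by positivity
  have hFi : ∀ k, IntervalIntegrable (F k) volume 0 t := fun k =>
    (intervalIntegrable_sub_rpow_mul_rpow ha (hbk k) ht).const_mul _
  have hsum : ∀ r ∈ Ioo 0 t, HasSum (fun k => F k r) ((t - r) ^ (a - 1) * mlFun γ μ b r) := by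
    intro r hr
    refine ((hasSum_mlFun hγ hb μ hr.1).mul_left ((t - r) ^ (a - 1))).congr_fun fun k => ?_
    simp only [hF]; ring
  have hFint : ∀ k, ∫ r in (0 : ℝ)..t, F k r =
      Real.Gamma a * ((-μ) ^ k * t ^ (γ * k + (a + b) - 1) / Real.Gamma (γ * k + (a + b))) := by
    intro k
    have := (Real.Gamma_pos_of_pos (hbk k)).ne'
    simp only [hF]
    rw [intervalIntegral.integral_const_mul, integral_sub_rpow_mul_rpow ha (hbk k) ht]
    rw [show γ * k + (a + b) = a + (γ * k + b) by ring]
    field_simp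
  have hFnorm : ∀ k, ∫ r in Ioc 0 t, ‖F k r‖ =
      Real.Gamma a * (|μ| ^ k * t ^ (γ * k + (a + b) - 1) / Real.Gamma (γ * k + (a + b))) := by
    intro k
    have hG := (Real.Gamma_pos_of_pos (hbk k))
    rw [← intervalIntegral.integral_of_le ht.le]
    have : ∀ r ∈ uIcc 0 t, ‖F k r‖ = (|μ| ^ k / Real.Gamma (γ * k + b)) *
        ((t - r) ^ (a - 1) * r ^ (γ * k + b - 1)) := by
      intro r hr
      rw [uIcc_of_le ht.le] at hr
      have h1 : 0 ≤ (t - r) ^ (a - 1) := Real.rpow_nonneg (sub_nonneg.2 hr.2) _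
      have h2 : 0 ≤ r ^ (γ * k + b - 1) := Real.rpow_nonneg hr.1 _
      simp only [hF, norm_mul, norm_div, norm_pow, norm_neg, Real.norm_eq_abs, abs_of_nonneg h1,
        abs_of_nonneg h2, abs_of_pos hG]
    rw [intervalIntegral.integral_congr this, intervalIntegral.integral_const_mul,
      integral_sub_rpow_mul_rpow ha (hbk k) ht, show γ * k + (a + b) = a + (γ * k + b) by ring]
    field_simp
  have hnsum : Summable fun k => ∫ r in Ioc 0 t, ‖F k r‖ := by
    simp only [hFnorm]
    -- At the parameter `-|μ|` all terms of the series are nonnegative and equal the integrals of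
    -- the norms.
    have := (hasSum_mlFun hγ (add_pos ha hb) (-|μ|) ht).summable.mul_left (Real.Gamma a)
    simpa using this
  have hFi' : ∀ k, Integrable (F k) (volume.restrict (Ioc 0 t)) := fun k =>
    (intervalIntegrable_iff_integrableOn_Ioc_of_le ht.le).1 (hFi k)
  have hae : ∀ᵐ r ∂(volume.restrict (Ioc 0 t)),
      HasSum (fun k => F k r) ((t - r) ^ (a - 1) * mlFun γ μ b r) := by
    rw [← restrict_Ioo_eq_restrict_Ioc]
    filter_upwards [ae_restrict_mem measurableSet_Ioo] with r hr using hsum r hr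
  have hmain := hasSum_integral_of_summable_integral_norm hFi' hnsum
  have hcongr : ∫ r in Ioc 0 t, ∑' k, F k r = ∫ r in Ioc 0 t, (t - r) ^ (a - 1) * mlFun γ μ b r :=
    integral_congr_ae (hae.mono fun r hr => hr.tsum_eq)
  constructor
  · have hc : Continuous fun r : ℝ => mittagLeffler γ b (-μ * r ^ γ) :=
      (continuous_mittagLeffler hγ hb).comp
        (continuous_const.mul (Real.continuous_rpow_const hγ.le))
    refine ((intervalIntegrable_sub_rpow_mul_rpow ha hb ht).mul_continuousOn
      hc.continuousOn).congr fun r _ => ?_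
    simp only [mlFun, mul_assoc]
  · rw [intervalIntegral.integral_of_le ht.le, ← hcongr]
    refine hmain.unique ?_
    refine ((hasSum_mlFun hγ (add_pos ha hb) μ ht).mul_left (Real.Gamma a)).congr_fun fun k => ?_
    rw [← intervalIntegral.integral_of_le ht.le, hFint]

/-- Split off the term `k = 0` and shift the index. -/
theorem mlFun_eq_sub {γ b t : ℝ} (hγ : 0 < γ) (hb : 0 < b) (μ : ℝ) (ht : 0 < t) :
    mlFun γ μ b t = t ^ (b - 1) / Real.Gamma b - μ * mlFun γ μ (γ + b) t := by
  have h := hasSum_mlFun hγ hb μ ht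
  have h2 := (hasSum_mlFun hγ (add_pos hγ hb) μ ht).mul_left (-μ)
  rw [← hasSum_nat_add_iff' 1] at h
  have h3 := h.unique (h2.congr_fun fun k => ?_)
  · simp at h3
    linarith
  · push_cast
    rw [show γ * ((k : ℝ) + 1) + b = γ * k + (γ + b) by ring, pow_succ]
    ring

/-! ### The scalar relaxation function `t ↦ E_γ(-μ t ^ γ)` -/

/-- The solution `E_γ(-μ t ^ γ)` of the scalar equation `∂^γ y = -μ y`, `y(0) = 1`. -/
def relax (γ μ t : ℝ) : ℝ := mittagLeffler γ 1 (-μ * t ^ γ)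

/-- The function `t ^ (γ - 1) E_{γ,γ}(-μ t ^ γ)`, for which `relax' = -μ * relaxKer`. -/
def relaxKer (γ μ t : ℝ) : ℝ := mlFun γ μ γ t

theorem mlFun_one (γ μ t : ℝ) : mlFun γ μ 1 t = relax γ μ t := by
  simp [mlFun, relax]

theorem relax_zero_right {γ : ℝ} (hγ : 0 < γ) (μ : ℝ) : relax γ μ 0 = 1 := by
  rw [relax, Real.zero_rpow hγ.ne', mul_zero, mittagLeffler, tsum_eq_single 0]
  · simp
  · intro k hk
    simp [hk]

theorem continuous_relax {γ : ℝ} (hγ : 0 < γ) (μ : ℝ) : Continuous (relax γ μ) :=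
  (continuous_mittagLeffler hγ one_pos).comp
    (continuous_const.mul (Real.continuous_rpow_const hγ.le))

theorem continuous_relax_left {γ : ℝ} (hγ : 0 < γ) (t : ℝ) : Continuous fun μ => relax γ μ t :=
  (continuous_mittagLeffler hγ one_pos).comp (by fun_prop)

theorem continuousOn_relaxKer {γ : ℝ} (hγ : 0 < γ) (μ : ℝ) :
    ContinuousOn (relaxKer γ μ) (Ioi 0) :=
  continuousOn_mlFun hγ hγ μ

theorem measurable_relaxKer {γ : ℝ} (hγ : 0 < γ) :
    Measurable fun p : ℝ × ℝ => relaxKer γ p.1 p.2 := by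
  have := (continuous_mittagLeffler hγ hγ).measurable
  unfold relaxKer mlFun
  fun_prop

theorem integral_relaxKer {γ t : ℝ} (hγ : 0 < γ) (μ : ℝ) (ht : 0 < t) :
    IntervalIntegrable (relaxKer γ μ) volume 0 t ∧
      ∫ r in (0 : ℝ)..t, relaxKer γ μ r = mlFun γ μ (γ + 1) t := by
  have h := intervalIntegrable_and_integral_mlFun hγ one_pos hγ μ ht
  simp only [sub_self, Real.rpow_zero, one_mul, Real.Gamma_one] at h
  rw [add_comm γ 1]
  exact h

theorem relax_eq_sub {γ t : ℝ} (hγ : 0 < γ) (μ : ℝ) (ht : 0 < t) :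
    relax γ μ t = 1 - μ * ∫ r in (0 : ℝ)..t, relaxKer γ μ r := by
  rw [← mlFun_one, mlFun_eq_sub hγ one_pos μ ht, (integral_relaxKer hγ μ ht).2]
  simp

/-- `relax` is `1 - μ` times a primitive of `relaxKer`, so the fundamental theorem of calculus
replaces termwise differentiation. The point `0` is excluded, since `relaxKer` may blow up there. -/
theorem hasDerivAt_relax {γ t : ℝ} (hγ : 0 < γ) (μ : ℝ) (ht : 0 < t) :
    HasDerivAt (relax γ μ) (-μ * relaxKer γ μ t) t := by
  have h1 : HasDerivAt (fun t => ∫ r in (0 : ℝ)..t, relaxKer γ μ r) (relaxKer γ μ t) t := by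
    have hc := continuousOn_relaxKer hγ μ
    exact intervalIntegral.integral_hasDerivAt_right (integral_relaxKer hγ μ ht).1
      (hc.stronglyMeasurableAtFilter isOpen_Ioi t ht) (hc.continuousAt (Ioi_mem_nhds ht))
  have h2 : HasDerivAt (fun t => 1 - μ * ∫ r in (0 : ℝ)..t, relaxKer γ μ r)
      (-μ * relaxKer γ μ t) t := by
    simpa using (h1.const_mul μ).const_sub 1
  refine h2.congr_of_eventuallyEq ?_
  filter_upwards [Ioi_mem_nhds ht] with r hr using relax_eq_sub hγ μ hr

/-- Fractional integration of order `1 - γ` applied at `b = γ`. Multiplied by `-μ`, this is the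
scalar equation `∂^γ relax = -μ relax`. -/
theorem integral_rpow_mul_relaxKer {γ t : ℝ} (hγ : γ ∈ Ioo (0 : ℝ) 1) (μ : ℝ) (ht : 0 < t) :
    IntervalIntegrable (fun r => (t - r) ^ (-γ) * relaxKer γ μ r) volume 0 t ∧
      ∫ r in (0 : ℝ)..t, (t - r) ^ (-γ) * relaxKer γ μ r = Real.Gamma (1 - γ) * relax γ μ t := by
  have h := intervalIntegrable_and_integral_mlFun hγ.1 (sub_pos.2 hγ.2) hγ.1 μ ht
  simp only [sub_add_cancel, mlFun_one, show 1 - γ - 1 = -γ by ring] at h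
  exact h

/-! ### Maximum principle, monotonicity and bounds for the relaxation function -/

/-- Integrate by parts against `y - y b` up to `c < b`: the term with `k'` has a sign, because `k`
increases and `y` is minimal at `b`. Then let `c → b`. The kernel may be singular at `b`, and `y`
need not be differentiable at `a`. -/
theorem integral_mul_deriv_le {a b : ℝ} (hab : a < b) {k k' y y' : ℝ → ℝ}
    (hk : ∀ r ∈ Ico a b, HasDerivAt k (k' r) r) (hk' : ContinuousOn k' (Ico a b))
    (hk0 : ∀ r ∈ Ico a b, 0 ≤ k' r) (hy : ContinuousOn y (Icc a b))
    (hy' : ∀ r ∈ Ioo a b, HasDerivAt y (y' r) r) (hyb : ∀ r ∈ Icc a b, y b ≤ y r)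
    (hint : IntervalIntegrable (fun r => k r * y' r) volume a b)
    (hlim : Tendsto (fun r => k r * (y r - y b)) (𝓝[<] b) (𝓝 0)) :
    ∫ r in a..b, k r * y' r ≤ -(k a * (y a - y b)) := by
  have h1 : Tendsto (fun c => ∫ r in a..c, k r * y' r) (𝓝[<] b)
      (𝓝 (∫ r in a..b, k r * y' r)) := by
    have h := intervalIntegral.continuousOn_primitive_interval' hint left_mem_uIcc b right_mem_uIcc
    rw [uIcc_of_le hab.le] at h
    exact h.tendsto.mono_left (nhdsWithin_le_of_mem (Icc_mem_nhdsLT hab))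
  have h2 : Tendsto (fun c => k c * (y c - y b) - k a * (y a - y b)) (𝓝[<] b)
      (𝓝 (0 - k a * (y a - y b))) := hlim.sub_const _
  rw [zero_sub] at h2
  refine le_of_tendsto_of_tendsto h1 h2 ?_
  filter_upwards [Ioo_mem_nhdsLT hab] with c hc
  have hsub : Icc a c ⊆ Ico a b := fun r hr => ⟨hr.1, hr.2.trans_lt hc.2⟩
  have hsub' : Icc a c ⊆ Icc a b := Icc_subset_Icc_right hc.2.le
  have hi1 : IntervalIntegrable (fun r => k r * y' r) volume a c :=
    hint.mono_set (by rw [uIcc_of_le hc.1.le, uIcc_of_le hab.le]; exact hsub')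
  have hi2 : IntervalIntegrable (fun r => k' r * (y r - y b)) volume a c := by
    refine ContinuousOn.intervalIntegrable ?_
    rw [uIcc_of_le hc.1.le]
    exact (hk'.mono hsub).mul ((hy.mono hsub').sub continuousOn_const)
  have hftc := intervalIntegral.integral_eq_sub_of_hasDerivAt_of_le hc.1.le
    (f := fun r => k r * (y r - y b)) (f' := fun r => k' r * (y r - y b) + k r * y' r)
    (ContinuousOn.mul (fun r hr => (hk r (hsub hr)).continuousAt.continuousWithinAt)
      ((hy.mono hsub').sub continuousOn_const))
    (fun r hr => (hk r (hsub (Ioo_subset_Icc_self hr))).mul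
      ((hy' r (Ioo_subset_Ioo_right hc.2.le hr)).sub_const _)) (hi2.add hi1)
  rw [intervalIntegral.integral_add hi2 hi1] at hftc
  have hpos : 0 ≤ ∫ r in a..c, k' r * (y r - y b) :=
    intervalIntegral.integral_nonneg hc.1.le fun r hr =>
      mul_nonneg (hk0 r (hsub hr)) (sub_nonneg.2 (hyb r (hsub' hr)))
  linarith

/-- The quantity is `-(b - r)^(1-γ)` times a difference quotient, so differentiability beats the
singularity. This is the boundary term at the upper endpoint in the previous lemma. -/
theorem tendsto_sub_rpow_mul_sub {γ b d : ℝ} (hγ : γ < 1) {y : ℝ → ℝ} (hy : HasDerivAt y d b) :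
    Tendsto (fun r => (b - r) ^ (-γ) * (y r - y b)) (𝓝[<] b) (𝓝 0) := by
  have h1 : Tendsto (slope y b) (𝓝[<] b) (𝓝 d) :=
    (hasDerivAt_iff_tendsto_slope.1 hy).mono_left
      (nhdsWithin_mono _ fun r hr => ne_of_lt hr)
  have h2 : Tendsto (fun r => (b - r) ^ (1 - γ)) (𝓝[<] b) (𝓝 0) := by
    have : ContinuousAt (fun r => (b - r) ^ (1 - γ)) b :=
      ContinuousAt.rpow_const (by fun_prop) (Or.inr (by linarith))
    have h := this.tendsto
    simp only [sub_self, Real.zero_rpow (sub_pos.2 hγ).ne'] at h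
    exact h.mono_left nhdsWithin_le_nhds
  have h3 := (h2.mul h1).neg
  rw [zero_mul, neg_zero] at h3
  refine h3.congr' ?_
  filter_upwards [self_mem_nhdsWithin] with r hr
  have hr' : 0 < b - r := sub_pos.2 hr
  rw [slope_def_field, sub_eq_add_neg 1 γ, Real.rpow_add hr', Real.rpow_one]
  have : r - b ≠ 0 := by linarith
  field_simp
  ring

theorem hasDerivAt_sub_rpow_neg {γ t r : ℝ} (hr : r < t) :
    HasDerivAt (fun r => (t - r) ^ (-γ)) (γ * (t - r) ^ (-γ - 1)) r := by
  have h := ((hasDerivAt_id r).const_sub t).rpow_const (p := -γ) (Or.inl (sub_pos.2 hr).ne')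
  simpa using h

theorem continuousOn_sub_rpow (t p : ℝ) : ContinuousOn (fun r => (t - r) ^ p) (Iio t) :=
  fun r hr => (ContinuousAt.rpow_const (by fun_prop)
    (Or.inl (sub_pos.2 hr).ne')).continuousWithinAt

/-- Suppose `relax` increases somewhere. Take its minimum `t₁` on `[0,b]`, then its maximum `t₂` on
`[t₁,b]`, and let `C(t)` be the Caputo integral. The equation `C(t) = -μ Γ(1-γ) relax t` gives
`C(t₂) < C(t₁)`. But the part of `C(t₂)` over `(t₁,t₂)` is positive since `t₂` is a maximum, and the
part over `(0,t₁)` is at least `C(t₁)` since `t₁` is a minimum and the difference of the two kernels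
is increasing. -/
theorem antitoneOn_relax {γ μ : ℝ} (hγ : γ ∈ Ioo (0 : ℝ) 1) (hμ : 0 < μ) :
    AntitoneOn (relax γ μ) (Ici 0) := by
  intro a ha b hb hab
  by_contra! hlt
  have hb0 : (0 : ℝ) ≤ b := hb
  have hcont := continuous_relax hγ.1 μ
  obtain ⟨t₁, ht₁, hmin⟩ := isCompact_Icc.exists_isMinOn (nonempty_Icc.2 hb0) hcont.continuousOn
  obtain ⟨t₂, ht₂, hmax⟩ :=
    isCompact_Icc.exists_isMaxOn (nonempty_Icc.2 ht₁.2) hcont.continuousOn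
  have h12 : relax γ μ t₁ < relax γ μ t₂ :=
    ((hmin ⟨ha, hab⟩).trans_lt hlt).trans_le (hmax ⟨ht₁.2, le_rfl⟩)
  have hlt12 : t₁ < t₂ := lt_of_le_of_ne ht₂.1 fun h => by simp [h] at h12
  have h02 : 0 < t₂ := ht₁.1.trans_lt hlt12
  have hγ' := hγ.1
  have hG : 0 < Real.Gamma (1 - γ) := Real.Gamma_pos_of_pos (sub_pos.2 hγ.2)
  have hcap : ∀ t, 0 < t → IntervalIntegrable (fun r => (t - r) ^ (-γ) * (-μ * relaxKer γ μ r))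
      volume 0 t ∧ ∫ r in (0 : ℝ)..t, (t - r) ^ (-γ) * (-μ * relaxKer γ μ r) =
        -(μ * Real.Gamma (1 - γ) * relax γ μ t) := by
    intro t ht
    obtain ⟨hi, he⟩ := integral_rpow_mul_relaxKer hγ μ ht
    have : (fun r => (t - r) ^ (-γ) * (-μ * relaxKer γ μ r)) =
        fun r => -μ * ((t - r) ^ (-γ) * relaxKer γ μ r) := by
      funext r; ring
    rw [this]
    refine ⟨hi.const_mul _, ?_⟩
    rw [intervalIntegral.integral_const_mul, he]
    ring
  obtain ⟨hi2, he2⟩ := hcap t₂ h02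
  have hi2a : IntervalIntegrable (fun r => (t₂ - r) ^ (-γ) * (-μ * relaxKer γ μ r)) volume 0 t₁ :=
    hi2.mono_set (by
      rw [uIcc_of_le ht₁.1, uIcc_of_le h02.le]; exact Icc_subset_Icc_right hlt12.le)
  have hi2b : IntervalIntegrable (fun r => (t₂ - r) ^ (-γ) * (-μ * relaxKer γ μ r)) volume t₁ t₂ :=
    hi2.mono_set (by
      rw [uIcc_of_le hlt12.le, uIcc_of_le h02.le]; exact Icc_subset_Icc_left ht₁.1)
  have hsplit := intervalIntegral.integral_add_adjacent_intervals hi2a hi2b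
  have hpart2 : 0 < ∫ r in t₁..t₂, (t₂ - r) ^ (-γ) * (-μ * relaxKer γ μ r) := by
    have h := integral_mul_deriv_le hlt12 (k := fun r => (t₂ - r) ^ (-γ))
      (k' := fun r => γ * (t₂ - r) ^ (-γ - 1)) (y := fun r => -relax γ μ r)
      (y' := fun r => -(-μ * relaxKer γ μ r))
      (fun r hr => hasDerivAt_sub_rpow_neg hr.2)
      (((continuousOn_sub_rpow t₂ _).const_smul γ).mono fun r hr => hr.2)
      (fun r hr => mul_nonneg hγ'.le (Real.rpow_nonneg (sub_pos.2 hr.2).le _))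
      hcont.neg.continuousOn
      (fun r hr => (hasDerivAt_relax hγ' μ (ht₁.1.trans_lt hr.1)).neg)
      (fun r hr => neg_le_neg (hmax ⟨hr.1, hr.2.trans ht₂.2⟩))
      (hi2b.neg.congr fun r _ => by simp)
      (tendsto_sub_rpow_mul_sub hγ.2 (hasDerivAt_relax hγ' μ h02).neg)
    have hk : 0 < (t₂ - t₁) ^ (-γ) := Real.rpow_pos_of_pos (sub_pos.2 hlt12) _
    have hneg : ∀ r, (t₂ - r) ^ (-γ) * -(-μ * relaxKer γ μ r) =
      -((t₂ - r) ^ (-γ) * (-μ * relaxKer γ μ r)) := fun r => by ring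
    simp only [hneg, intervalIntegral.integral_neg] at h
    nlinarith [mul_pos hk (sub_pos.2 h12)]
  rcases ht₁.1.eq_or_lt with h0 | h01
  -- If the minimum is at `0`, then `relax t₂ > 1`, so the equation makes the integral up to `t₂`
  -- negative, contradicting `hpart2`.
  · subst h0
    rw [intervalIntegral.integral_same, zero_add] at hsplit
    rw [relax_zero_right hγ'] at h12
    have : 0 < μ * Real.Gamma (1 - γ) * relax γ μ t₂ := by positivity
    linarith
  · obtain ⟨hi1, he1⟩ := hcap t₁ h01
    have hpart1 : ∫ r in (0 : ℝ)..t₁,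
        ((t₁ - r) ^ (-γ) - (t₂ - r) ^ (-γ)) * (-μ * relaxKer γ μ r) ≤ 0 := by
      refine (integral_mul_deriv_le h01 (k := fun r => (t₁ - r) ^ (-γ) - (t₂ - r) ^ (-γ))
        (k' := fun r => γ * (t₁ - r) ^ (-γ - 1) - γ * (t₂ - r) ^ (-γ - 1)) (y := relax γ μ)
        (y' := fun r => -μ * relaxKer γ μ r)
        (fun r hr => (hasDerivAt_sub_rpow_neg hr.2).sub
          (hasDerivAt_sub_rpow_neg (hr.2.trans hlt12))) ?_ ?_ hcont.continuousOn
        (fun r hr => hasDerivAt_relax hγ' μ hr.1)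
        (fun r hr => hmin ⟨hr.1, hr.2.trans ht₁.2⟩) ?_ ?_).trans ?_
      · exact (((continuousOn_sub_rpow t₁ _).const_smul γ).mono fun r hr => hr.2).sub
          (((continuousOn_sub_rpow t₂ _).const_smul γ).mono fun r hr => hr.2.trans hlt12)
      · intro r hr
        rw [← mul_sub]
        refine mul_nonneg hγ'.le (sub_nonneg.2 ?_)
        exact Real.rpow_le_rpow_of_nonpos (sub_pos.2 hr.2) (by linarith) (by linarith)
      · simpa only [sub_mul] using hi1.sub hi2a
      · have hA := tendsto_sub_rpow_mul_sub hγ.2 (hasDerivAt_relax hγ' μ h01)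
        have hB : Tendsto (fun r => (t₂ - r) ^ (-γ) * (relax γ μ r - relax γ μ t₁)) (𝓝[<] t₁)
            (𝓝 0) := by
          have : ContinuousAt (fun r => (t₂ - r) ^ (-γ) * (relax γ μ r - relax γ μ t₁)) t₁ :=
            ((continuousOn_sub_rpow t₂ _).continuousAt (Iio_mem_nhds hlt12)).mul
              (hcont.continuousAt.sub continuousAt_const)
          have h := this.tendsto
          simp only [sub_self, mul_zero] at h
          exact h.mono_left nhdsWithin_le_nhds
        simpa [sub_mul] using hA.sub hB
      · refine neg_nonpos.2 (mul_nonneg (sub_nonneg.2 ?_) (sub_nonneg.2 (hmin ⟨le_rfl, hb0⟩)))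
        exact Real.rpow_le_rpow_of_nonpos (by linarith) (by linarith) (by linarith)
    simp only [sub_mul] at hpart1
    rw [intervalIntegral.integral_sub hi1 hi2a, he1] at hpart1
    have : 0 < μ * Real.Gamma (1 - γ) * (relax γ μ t₂ - relax γ μ t₁) := by
      have := sub_pos.2 h12
      positivity
    nlinarith

theorem relax_zero_left {γ : ℝ} (hγ : 0 < γ) (t : ℝ) : relax γ 0 t = 1 := by
  have := relax_zero_right hγ 0
  simpa [relax] using this

theorem relax_le_one {γ μ t : ℝ} (hγ : γ ∈ Ioo (0 : ℝ) 1) (hμ : 0 ≤ μ) (ht : 0 ≤ t) :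
    relax γ μ t ≤ 1 := by
  rcases hμ.eq_or_lt with rfl | hμ
  · rw [relax_zero_left hγ.1]
  · simpa [relax_zero_right hγ.1] using antitoneOn_relax hγ hμ (self_mem_Ici) ht ht

/-- By monotonicity `t` minimizes `relax` on `[0,t]`, so integration by parts bounds the Caputo
integral above by `-t^(-γ) (1 - relax t)`. The equation says that it equals `-μ Γ(1-γ) relax t`;
solve for `relax t`. -/
theorem one_le_relax_mul {γ μ t : ℝ} (hγ : γ ∈ Ioo (0 : ℝ) 1) (hμ : 0 ≤ μ) (ht : 0 ≤ t) :
    1 ≤ relax γ μ t * (1 + μ * Real.Gamma (1 - γ) * t ^ γ) := by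
  rcases hμ.eq_or_lt with rfl | hμ
  · simp [relax_zero_left hγ.1]
  rcases ht.eq_or_lt with rfl | ht
  · simp [relax_zero_right hγ.1, Real.zero_rpow hγ.1.ne']
  obtain ⟨hi, he⟩ := integral_rpow_mul_relaxKer hγ μ ht
  have hfun : (fun r => (t - r) ^ (-γ) * (-μ * relaxKer γ μ r)) =
      fun r => -μ * ((t - r) ^ (-γ) * relaxKer γ μ r) := by
    funext r; ring
  have h := integral_mul_deriv_le ht (k := fun r => (t - r) ^ (-γ))
    (k' := fun r => γ * (t - r) ^ (-γ - 1)) (y := relax γ μ)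
    (y' := fun r => -μ * relaxKer γ μ r)
    (fun r hr => hasDerivAt_sub_rpow_neg hr.2)
    (((continuousOn_sub_rpow t _).const_smul γ).mono fun r hr => hr.2)
    (fun r hr => mul_nonneg hγ.1.le (Real.rpow_nonneg (sub_pos.2 hr.2).le _))
    (continuous_relax hγ.1 μ).continuousOn
    (fun r hr => hasDerivAt_relax hγ.1 μ hr.1)
    (fun r hr => antitoneOn_relax hγ hμ hr.1 ht.le hr.2)
    (by rw [hfun]; exact hi.const_mul _)
    (tendsto_sub_rpow_mul_sub hγ.2 (hasDerivAt_relax hγ.1 μ ht))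
  rw [hfun, intervalIntegral.integral_const_mul, he, relax_zero_right hγ.1, sub_zero,
    Real.rpow_neg ht.le] at h
  have htp : 0 < t ^ γ := Real.rpow_pos_of_pos ht _
  have h' := mul_le_mul_of_nonneg_left h htp.le
  rw [mul_neg, ← mul_assoc (t ^ γ) (t ^ γ)⁻¹, mul_inv_cancel₀ htp.ne', one_mul] at h'
  nlinarith

theorem relax_pos {γ μ t : ℝ} (hγ : γ ∈ Ioo (0 : ℝ) 1) (hμ : 0 ≤ μ) (ht : 0 ≤ t) :
    0 < relax γ μ t := by
  have hG : 0 < Real.Gamma (1 - γ) := Real.Gamma_pos_of_pos (sub_pos.2 hγ.2)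
  have : 0 < 1 + μ * Real.Gamma (1 - γ) * t ^ γ := by positivity
  exact pos_of_mul_pos_left (one_pos.trans_le (one_le_relax_mul hγ hμ ht)) this.le

theorem relaxKer_zero {γ t : ℝ} (hγ : 0 < γ) (ht : 0 < t) :
    relaxKer γ 0 t = t ^ (γ - 1) / Real.Gamma γ := by
  rw [relaxKer, mlFun_eq_sub hγ hγ 0 ht, zero_mul, sub_zero]

theorem relaxKer_nonneg {γ μ t : ℝ} (hγ : γ ∈ Ioo (0 : ℝ) 1) (hμ : 0 ≤ μ) (ht : 0 < t) :
    0 ≤ relaxKer γ μ t := by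
  have hG : 0 < Real.Gamma γ := Real.Gamma_pos_of_pos hγ.1
  rcases hμ.eq_or_lt with rfl | hμ
  · rw [relaxKer_zero hγ.1 ht]
    positivity
  have h1 := ((hasDerivAt_relax hγ.1 μ ht).hasDerivWithinAt (s := Ici 0)).derivWithin
    (uniqueDiffOn_Ici 0 t ht.le)
  have h2 := (antitoneOn_relax hγ hμ).derivWithin_nonpos (x := t)
  rw [h1] at h2
  nlinarith

/-- The correction to `t^(γ-1)/Γ(γ)` is `-μ` times a fractional integral of the nonnegative function
`relaxKer`. The bound is uniform in `μ`, as needed to pass to multiplication operators. -/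
theorem relaxKer_le {γ μ t : ℝ} (hγ : γ ∈ Ioo (0 : ℝ) 1) (hμ : 0 ≤ μ) (ht : 0 < t) :
    relaxKer γ μ t ≤ t ^ (γ - 1) / Real.Gamma γ := by
  have hG : 0 < Real.Gamma γ := Real.Gamma_pos_of_pos hγ.1
  have h := (intervalIntegrable_and_integral_mlFun hγ.1 hγ.1 hγ.1 μ ht).2
  have h0 : 0 ≤ ∫ r in (0 : ℝ)..t, (t - r) ^ (γ - 1) * mlFun γ μ γ r := by
    refine intervalIntegral.integral_nonneg_of_ae_restrict ht.le ?_
    rw [← restrict_Ioo_eq_restrict_Icc]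
    filter_upwards [ae_restrict_mem measurableSet_Ioo] with r hr
    exact mul_nonneg (Real.rpow_nonneg (sub_pos.2 hr.2).le _) (relaxKer_nonneg hγ hμ hr.1)
  rw [h] at h0
  have := nonneg_of_mul_nonneg_right h0 hG
  rw [relaxKer, mlFun_eq_sub hγ.1 hγ.1 μ ht]
  nlinarith [mul_nonneg hμ this]

/-! ### Uniqueness for abstract fractional evolution equations -/

section Abstract

variable {E : Type*} [NormedAddCommGroup E] [NormedSpace ℝ E]

theorem abelKernel_integral {γ r t : ℝ} (hγ : γ ∈ Ioo (0 : ℝ) 1) (hrt : r < t) :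
    IntervalIntegrable (fun q => (t - q) ^ (γ - 1) * (q - r) ^ (-γ)) volume r t ∧
      ∫ q in r..t, (t - q) ^ (γ - 1) * (q - r) ^ (-γ) = Real.Gamma γ * Real.Gamma (1 - γ) := by
  have h0 : 0 < t - r := sub_pos.2 hrt
  have hi := intervalIntegrable_sub_rpow_mul_rpow hγ.1 (sub_pos.2 hγ.2) h0
  have he := integral_sub_rpow_mul_rpow hγ.1 (sub_pos.2 hγ.2) h0
  rw [show γ + (1 - γ) = 1 by ring, sub_self, Real.rpow_zero, Real.Gamma_one, div_one,
    one_mul] at he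
  have hfun : (fun q => (t - q) ^ (γ - 1) * (q - r) ^ (-γ)) =
      fun q => (fun p => (t - r - p) ^ (γ - 1) * p ^ (1 - γ - 1)) (q - r) := by
    funext q
    simp only
    congr 2 <;> ring
  constructor
  · rw [hfun]
    simpa using hi.comp_sub_right r
  · rw [hfun, intervalIntegral.integral_comp_sub_right
      (fun p => (t - r - p) ^ (γ - 1) * p ^ (1 - γ - 1)), sub_self, he]

theorem intervalIntegrable_sub_rpow_smul {γ a t : ℝ} (hγ : 0 < γ) (ha : 0 ≤ a) (hat : a ≤ t)
    {D : ℝ → E} (hD : ContinuousOn D (Icc 0 t)) :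
    IntervalIntegrable (fun q => (t - q) ^ (γ - 1) • D q) volume a t := by
  have h1 : IntervalIntegrable (fun q : ℝ => (t - q) ^ (γ - 1)) volume a t := by
    have := (intervalIntegral.intervalIntegrable_rpow' (a := t - a) (b := 0)
      (show -1 < γ - 1 by linarith)).comp_sub_left t
    simpa using this
  refine h1.smul_continuousOn ?_
  rw [uIcc_of_le hat]
  exact hD.mono (Icc_subset_Icc_left ha)

variable [CompleteSpace E]

/-- Fubini on the triangle `ε < r < q < t`: the integral over `q` of the product kernel is the
constant `Γ(γ) Γ(1-γ)`. -/
theorem abel_inversion {γ ε t : ℝ} (hγ : γ ∈ Ioo (0 : ℝ) 1) (hεt : ε < t) {f : ℝ → E}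
    (hf : IntervalIntegrable f volume ε t) :
    IntervalIntegrable (fun q => (t - q) ^ (γ - 1) • ∫ r in ε..q, (q - r) ^ (-γ) • f r)
        volume ε t ∧
      ∫ q in ε..t, (t - q) ^ (γ - 1) • ∫ r in ε..q, (q - r) ^ (-γ) • f r =
        (Real.Gamma γ * Real.Gamma (1 - γ)) • ∫ r in ε..t, f r := by
  set μ : Measure ℝ := volume.restrict (Ioc ε t) with hμ
  have hGG : 0 < Real.Gamma γ * Real.Gamma (1 - γ) :=
    mul_pos (Real.Gamma_pos_of_pos hγ.1) (Real.Gamma_pos_of_pos (sub_pos.2 hγ.2))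
  set K : ℝ → ℝ → ℝ := fun q r => if r < q then (t - q) ^ (γ - 1) * (q - r) ^ (-γ) else 0 with hK
  have hKm : Measurable fun p : ℝ × ℝ => K p.1 p.2 :=
    Measurable.ite (measurableSet_lt measurable_snd measurable_fst) (by fun_prop) measurable_const
  have hf' : Integrable f μ := (intervalIntegrable_iff_integrableOn_Ioc_of_le hεt.le).1 hf
  have hKq : ∀ r ∈ Ioo ε t, Integrable (fun q => K q r) μ ∧
      ∫ q, K q r ∂μ = Real.Gamma γ * Real.Gamma (1 - γ) ∧ ∀ᵐ q ∂μ, 0 ≤ K q r := by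
    intro r hr
    obtain ⟨hi, he⟩ := abelKernel_integral hγ hr.2
    have hind : (fun q => K q r) = (Ioi r).indicator
        fun q => (t - q) ^ (γ - 1) * (q - r) ^ (-γ) := by
      funext q; simp [hK, indicator]
    have hset : Ioc ε t ∩ Ioi r = Ioc r t := by
      ext q; simp only [mem_inter_iff, mem_Ioc, mem_Ioi]
      constructor
      · rintro ⟨⟨_, h2⟩, h3⟩; exact ⟨h3, h2⟩
      · rintro ⟨h1, h2⟩; exact ⟨⟨hr.1.trans h1, h2⟩, h1⟩
    refine ⟨?_, ?_, ?_⟩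
    · rw [hind, hμ, integrable_indicator_iff measurableSet_Ioi, IntegrableOn,
        Measure.restrict_restrict measurableSet_Ioi, inter_comm, hset]
      exact (intervalIntegrable_iff_integrableOn_Ioc_of_le hr.2.le).1 hi
    · rw [hind, hμ, integral_indicator measurableSet_Ioi,
        Measure.restrict_restrict measurableSet_Ioi, inter_comm, hset,
        ← intervalIntegral.integral_of_le hr.2.le, he]
    · filter_upwards [ae_restrict_mem measurableSet_Ioc] with q hq
      simp only [hK]
      split_ifs with h
      · exact mul_nonneg (Real.rpow_nonneg (sub_nonneg.2 hq.2) _)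
          (Real.rpow_nonneg (sub_pos.2 h).le _)
      · exact le_rfl
  have haer : ∀ᵐ r ∂μ, r ∈ Ioo ε t := by
    rw [hμ, ← restrict_Ioo_eq_restrict_Ioc]
    exact ae_restrict_mem measurableSet_Ioo
  have hprod : Integrable (Function.uncurry fun q r => K q r • f r) (μ.prod μ) := by
    have hm : AEStronglyMeasurable (Function.uncurry fun q r => K q r • f r) (μ.prod μ) :=
      (hKm.aestronglyMeasurable (μ := μ.prod μ)).smul (hf'.1.comp_snd (μ := μ))
    rw [integrable_prod_iff' hm]
    constructor
    · filter_upwards [haer] with r hr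
      exact (hKq r hr).1.smul_const (f r)
    · refine (hf'.norm.const_mul (Real.Gamma γ * Real.Gamma (1 - γ))).congr ?_
      filter_upwards [haer] with r hr
      obtain ⟨_, h2, h3⟩ := hKq r hr
      rw [← h2, ← integral_mul_const]
      refine integral_congr_ae ?_
      filter_upwards [h3] with q hq
      simp only [Function.uncurry, norm_smul, Real.norm_of_nonneg hq]
  have hinner : ∀ q ∈ Ioc ε t, ∫ r, K q r • f r ∂μ =
      (t - q) ^ (γ - 1) • ∫ r in ε..q, (q - r) ^ (-γ) • f r := by
    intro q hq
    have hind : (fun r => K q r • f r) = (Iio q).indicator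
        fun r => (t - q) ^ (γ - 1) • ((q - r) ^ (-γ) • f r) := by
      funext r
      by_cases h : r < q
      · simp [hK, indicator, h, mul_smul]
      · simp [hK, indicator, h]
    have hset : Ioc ε t ∩ Iio q = Ioo ε q := by
      ext r; simp only [mem_inter_iff, mem_Ioc, mem_Iio, mem_Ioo]
      constructor
      · rintro ⟨⟨h1, _⟩, h3⟩; exact ⟨h1, h3⟩
      · rintro ⟨h1, h2⟩; exact ⟨⟨h1, (h2.trans_le hq.2).le⟩, h2⟩
    rw [hind, hμ, integral_indicator measurableSet_Iio,
      Measure.restrict_restrict measurableSet_Iio, inter_comm, hset, integral_smul,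
      intervalIntegral.integral_of_le hq.1.le, restrict_Ioo_eq_restrict_Ioc]
  have hae : (fun q => ∫ r, K q r • f r ∂μ) =ᵐ[μ]
      fun q => (t - q) ^ (γ - 1) • ∫ r in ε..q, (q - r) ^ (-γ) • f r := by
    filter_upwards [ae_restrict_mem measurableSet_Ioc] with q hq using hinner q hq
  constructor
  · rw [intervalIntegrable_iff_integrableOn_Ioc_of_le hεt.le]
    exact hprod.integral_prod_left.congr hae
  · rw [intervalIntegral.integral_of_le hεt.le, intervalIntegral.integral_of_le hεt.le,
      ← integral_congr_ae hae, integral_integral_swap hprod, ← integral_smul]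
    refine integral_congr_ae ?_
    filter_upwards [haer] with r hr
    rw [integral_smul_const, (hKq r hr).2.1]

/-- Integration by parts moves the derivative to the increasing kernel; the contributions at `δ`
cancel in the bound, making it independent of `δ`. Only the size of `y` enters, as `y'` may fail to
be integrable at `0`. -/
theorem norm_integral_rpow_smul_deriv_le {γ δ ε q M : ℝ} (hγ : 0 < γ) (hδε : δ ≤ ε) (hεq : ε < q)
    {y : ℝ → E} (hy : ∀ r ∈ Icc δ ε, DifferentiableAt ℝ y r)
    (hint : IntervalIntegrable (fun r => (q - r) ^ (-γ) • deriv y r) volume δ ε)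
    (hM : ∀ r ∈ Icc δ ε, ‖y r‖ ≤ M) :
    ‖∫ r in δ..ε, (q - r) ^ (-γ) • deriv y r‖ ≤ 2 * M * (q - ε) ^ (-γ) := by
  have hlt : ∀ r ∈ Icc δ ε, r < q := fun r hr => hr.2.trans_lt hεq
  have hk : ContinuousOn (fun r => γ * (q - r) ^ (-γ - 1)) (Icc δ ε) :=
    ((continuousOn_sub_rpow q _).const_smul γ).mono hlt
  have hyc : ContinuousOn y (Icc δ ε) := fun r hr => (hy r hr).continuousAt.continuousWithinAt
  have hi : IntervalIntegrable (fun r => (γ * (q - r) ^ (-γ - 1)) • y r) volume δ ε := by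
    refine ContinuousOn.intervalIntegrable ?_
    rw [uIcc_of_le hδε]
    exact hk.smul hyc
  have hki : IntervalIntegrable (fun r => γ * (q - r) ^ (-γ - 1)) volume δ ε := by
    refine ContinuousOn.intervalIntegrable ?_
    rwa [uIcc_of_le hδε]
  have h1 := intervalIntegral.integral_eq_sub_of_hasDerivAt
    (f := fun r => (q - r) ^ (-γ) • y r) (a := δ) (b := ε)
    (f' := fun r => (q - r) ^ (-γ) • deriv y r + (γ * (q - r) ^ (-γ - 1)) • y r)
    (fun r hr => by
      rw [uIcc_of_le hδε] at hr
      exact (hasDerivAt_sub_rpow_neg (hlt r hr)).smul (hy r hr).hasDerivAt) (hint.add hi)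
  rw [intervalIntegral.integral_add hint hi] at h1
  have h2 := intervalIntegral.integral_eq_sub_of_hasDerivAt
    (f := fun r => (q - r) ^ (-γ)) (a := δ) (b := ε) (f' := fun r => γ * (q - r) ^ (-γ - 1))
    (fun r hr => by
      rw [uIcc_of_le hδε] at hr
      exact hasDerivAt_sub_rpow_neg (hlt r hr)) hki
  have h3 : ‖∫ r in δ..ε, (γ * (q - r) ^ (-γ - 1)) • y r‖ ≤
      M * ((q - ε) ^ (-γ) - (q - δ) ^ (-γ)) := by
    rw [← h2, ← intervalIntegral.integral_const_mul]
    refine intervalIntegral.norm_integral_le_of_norm_le hδε ?_ (hki.const_mul M)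
    refine ae_of_all _ fun r hr => ?_
    have hr' := Ioc_subset_Icc_self hr
    have : 0 ≤ γ * (q - r) ^ (-γ - 1) :=
      mul_nonneg hγ.le (Real.rpow_nonneg (sub_pos.2 (hlt r hr')).le _)
    rw [norm_smul, Real.norm_of_nonneg this, mul_comm]
    exact mul_le_mul_of_nonneg_right (hM r hr') this
  have h4 : ∫ r in δ..ε, (q - r) ^ (-γ) • deriv y r = (q - ε) ^ (-γ) • y ε -
      (q - δ) ^ (-γ) • y δ - ∫ r in δ..ε, (γ * (q - r) ^ (-γ - 1)) • y r := by
    rw [← h1]; abel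
  have hb : ∀ r ∈ Icc δ ε, ‖(q - r) ^ (-γ) • y r‖ ≤ (q - r) ^ (-γ) * M := fun r hr => by
    have : 0 ≤ (q - r) ^ (-γ) := Real.rpow_nonneg (sub_pos.2 (hlt r hr)).le _
    rw [norm_smul, Real.norm_of_nonneg this]
    exact mul_le_mul_of_nonneg_left (hM r hr) this
  rw [h4]
  refine (norm_sub_le _ _).trans ?_
  have h5 := norm_sub_le ((q - ε) ^ (-γ) • y ε) ((q - δ) ^ (-γ) • y δ)
  have h6 := hb ε ⟨hδε, le_rfl⟩
  have h7 := hb δ ⟨le_rfl, hδε⟩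
  linarith

theorem caputo_truncation_error {γ ε q M : ℝ} (hγ : γ ∈ Ioo (0 : ℝ) 1) (hε : ε ∈ Ioo 0 q)
    {y : ℝ → E} {D : E} (hD : HasCaputoDerivAt γ y D q) (hM : ∀ r ∈ Icc 0 ε, ‖y r‖ ≤ M) :
    ‖(∫ r in ε..q, (q - r) ^ (-γ) • deriv y r) - Real.Gamma (1 - γ) • D‖ ≤
      2 * M * (q - ε) ^ (-γ) := by
  obtain ⟨hdiff, hint, hlim⟩ := hD
  have hG : Real.Gamma (1 - γ) ≠ 0 := (Real.Gamma_pos_of_pos (sub_pos.2 hγ.2)).ne'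
  have hlim' : Tendsto (fun δ => ∫ r in δ..q, (q - r) ^ (-γ) • deriv y r) (𝓝[>] 0)
      (𝓝 (Real.Gamma (1 - γ) • D)) := by
    simpa [smul_smul, hG] using hlim.const_smul (Real.Gamma (1 - γ))
  refine le_of_tendsto (tendsto_const_nhds.sub hlim').norm ?_
  filter_upwards [Ioo_mem_nhdsGT hε.1] with δ hδ
  have hδq : δ ∈ Ioo 0 q := ⟨hδ.1, hδ.2.trans hε.2⟩
  have hiδ : IntervalIntegrable (fun r => (q - r) ^ (-γ) • deriv y r) volume δ ε :=
    (hint δ hδq).mono_set (by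
      rw [uIcc_of_le hδ.2.le, uIcc_of_le hδq.2.le]; exact Icc_subset_Icc_right hε.2.le)
  rw [← intervalIntegral.integral_add_adjacent_intervals hiδ (hint ε hε), sub_add_cancel_right,
    norm_neg]
  exact norm_integral_rpow_smul_deriv_le hγ.1 hδ.2.le hε.2
    (fun r hr => hdiff r ⟨hδ.1.trans_le hr.1, hr.2.trans_lt hε.2⟩) hiδ
    fun r hr => hM r ⟨hδ.1.le.trans hr.1, hr.2⟩

/-- A curve vanishing at `0` is the fractional integral of its Caputo derivative. -/
theorem eq_fractionalIntegral_of_caputo {γ T : ℝ} (hγ : γ ∈ Ioo (0 : ℝ) 1) {y D : ℝ → E}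
    (hy : ContinuousOn y (Ico 0 T)) (hy0 : y 0 = 0) (hD : ContinuousOn D (Ico 0 T))
    (hcap : ∀ t ∈ Ioo 0 T, HasCaputoDerivAt γ y (D t) t) {t : ℝ} (ht : t ∈ Ioo 0 T) :
    Real.Gamma γ • y t = ∫ q in (0 : ℝ)..t, (t - q) ^ (γ - 1) • D q := by
  set G := Real.Gamma γ with hGdef
  set G' := Real.Gamma (1 - γ) with hGdef'
  have hG : 0 < G := Real.Gamma_pos_of_pos hγ.1
  have hG' : 0 < G' := Real.Gamma_pos_of_pos (sub_pos.2 hγ.2)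
  have hdiff : ∀ r ∈ Ioo 0 T, DifferentiableAt ℝ y r := fun r hr => by
    obtain ⟨c, hc⟩ := exists_between hr.2
    exact (hcap c ⟨hr.1.trans hc.1, hc.2⟩).1 r ⟨hr.1, hc.1⟩
  have hsub : Icc 0 t ⊆ Ico 0 T := fun r hr => ⟨hr.1, hr.2.trans_lt ht.2⟩
  have hDi : ∀ a, 0 ≤ a → a ≤ t → IntervalIntegrable (fun q => (t - q) ^ (γ - 1) • D q)
      volume a t := fun a ha hat =>
    intervalIntegrable_sub_rpow_smul hγ.1 ha hat (hD.mono hsub)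
  have hDi0 := hDi 0 le_rfl ht.1.le
  have hlim : Tendsto (fun ε => ‖(G * G') • (y t - y ε) -
      G' • ∫ q in ε..t, (t - q) ^ (γ - 1) • D q‖) (𝓝[>] 0)
      (𝓝 ‖(G * G') • (y t - y 0) - G' • ∫ q in (0 : ℝ)..t, (t - q) ^ (γ - 1) • D q‖) := by
    refine Tendsto.norm (Tendsto.sub ((Tendsto.const_smul ?_ _)) (Tendsto.const_smul ?_ _))
    · refine tendsto_const_nhds.sub ?_
      have h := hy 0 ⟨le_rfl, ht.1.trans ht.2⟩
      refine h.tendsto.mono_left (nhdsWithin_le_of_mem ?_)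
      exact Ico_mem_nhdsGT (ht.1.trans ht.2)
    · have h := intervalIntegral.continuousOn_primitive_interval' hDi0 right_mem_uIcc 0
        left_mem_uIcc
      rw [uIcc_of_le ht.1.le] at h
      have h' := (h.tendsto.mono_left (nhdsWithin_le_of_mem (Icc_mem_nhdsGT ht.1))).neg
      simpa only [← intervalIntegral.integral_symm] using h'
  have hzero : ‖(G * G') • (y t - y 0) - G' • ∫ q in (0 : ℝ)..t, (t - q) ^ (γ - 1) • D q‖ ≤ 0 := by
    refine le_of_forall_pos_le_add fun η hη => ?_
    rw [zero_add]
    -- Integrating the truncation error `2M(q - ε)^(-γ)` against the Abel kernel gives `2M Γ(γ)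
    -- Γ(1-γ)`, which is exactly `η`. Continuity and `y 0 = 0` provide this `M` near `0`.
    set M := η / (2 * (G * G')) with hMdef
    have hM : 0 < M := by positivity
    obtain ⟨ε₀, hε₀, hε₀M⟩ : ∃ ε₀ > 0, ∀ r ∈ Ico 0 ε₀, r < T → ‖y r‖ ≤ M := by
      have h := Metric.continuousWithinAt_iff.1 (hy 0 ⟨le_rfl, ht.1.trans ht.2⟩) M hM
      obtain ⟨ε₀, hε₀, h⟩ := h
      refine ⟨ε₀, hε₀, fun r hr hrT => ?_⟩
      have := h (x := r) ⟨hr.1, hrT⟩ (by simpa [abs_of_nonneg hr.1] using hr.2)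
      rw [hy0, dist_zero_right] at this
      exact this.le
    refine le_of_tendsto hlim ?_
    filter_upwards [Ioo_mem_nhdsGT (lt_min hε₀ ht.1)] with ε hε
    have hεt : ε < t := hε.2.trans_le (min_le_right _ _)
    have hεM : ∀ r ∈ Icc 0 ε, ‖y r‖ ≤ M := fun r hr =>
      hε₀M r ⟨hr.1, hr.2.trans_lt (hε.2.trans_le (min_le_left _ _))⟩
        (hr.2.trans_lt (hεt.trans ht.2))
    -- The integrand of the Caputo derivative at `t` is integrable; multiplying by the continuous
    -- factor `(t - r)^γ` removes its weight.
    have hdi : IntervalIntegrable (deriv y) volume ε t := by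
      have h1 := (hcap t ht).2.1 ε ⟨hε.1, hεt⟩
      have h2 : ContinuousOn (fun r => (t - r) ^ γ) (uIcc ε t) := fun r _ =>
        (ContinuousAt.rpow_const (by fun_prop) (Or.inr hγ.1.le)).continuousWithinAt
      have h3 := h1.continuousOn_smul h2
      rw [intervalIntegrable_iff_integrableOn_Ioo_of_le hεt.le] at h3 ⊢
      refine h3.congr_fun (fun r hr => ?_) measurableSet_Ioo
      have : 0 < t - r := sub_pos.2 hr.2
      simp only
      rw [smul_smul, ← Real.rpow_add this, add_neg_cancel, Real.rpow_zero, one_smul]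
    obtain ⟨hJi, hJ⟩ := abel_inversion hγ hεt hdi
    rw [intervalIntegral.integral_deriv_eq_sub (fun r hr => by
      rw [uIcc_of_le hεt.le] at hr
      exact hdiff r ⟨hε.1.trans_le hr.1, hr.2.trans_lt ht.2⟩) hdi] at hJ
    rw [← hJ, ← intervalIntegral.integral_smul, ← intervalIntegral.integral_sub hJi
      (by exact (hDi ε hε.1.le hεt.le).smul G')]
    obtain ⟨hKi, hK⟩ := abelKernel_integral hγ hεt
    have hη : η = ∫ q in ε..t, 2 * M * ((t - q) ^ (γ - 1) * (q - ε) ^ (-γ)) := by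
      rw [intervalIntegral.integral_const_mul, hK, hMdef, ← hGdef, ← hGdef']
      field_simp
    rw [hη]
    refine intervalIntegral.norm_integral_le_of_norm_le hεt.le ?_ (hKi.const_mul (2 * M))
    refine ae_of_all _ fun q hq => ?_
    rw [smul_comm G', ← smul_sub, norm_smul,
      Real.norm_of_nonneg (Real.rpow_nonneg (sub_nonneg.2 hq.2) _)]
    have := caputo_truncation_error hγ ⟨hε.1, hq.1⟩
      (hcap q ⟨hε.1.trans hq.1, hq.2.trans_lt ht.2⟩) hεM
    calc _ ≤ (t - q) ^ (γ - 1) * (2 * M * (q - ε) ^ (-γ)) := by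
          gcongr
          exact Real.rpow_nonneg (sub_nonneg.2 hq.2) _
      _ = _ := by ring
  have h := norm_le_zero_iff.1 hzero
  rw [hy0, sub_zero, mul_comm G G', mul_smul, ← smul_sub, smul_eq_zero, sub_eq_zero] at h
  exact h.resolve_left hG'.ne'

/-- A solution of the linear fractional equation `∂^γ y = B y` with `y(0) = 0` vanishes. -/
theorem eq_zero_of_caputo_linear {γ T : ℝ} (hγ : γ ∈ Ioo (0 : ℝ) 1) (hT : 0 < T) {y : ℝ → E}
    (B : E →L[ℝ] E) (hy : ContinuousOn y (Icc 0 T)) (hy0 : y 0 = 0)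
    (hcap : ∀ t ∈ Ioo 0 T, HasCaputoDerivAt γ y (B (y t)) t) :
    ∀ t ∈ Icc 0 T, y t = 0 := by
  have hG : 0 < Real.Gamma γ := Real.Gamma_pos_of_pos hγ.1
  obtain ⟨M, hM⟩ := isCompact_Icc.exists_bound_of_continuousOn hy
  have hM0 : 0 ≤ M := (norm_nonneg _).trans (hM 0 ⟨le_rfl, hT.le⟩)
  have hvolt : ∀ t ∈ Ioo 0 T, Real.Gamma γ • y t =
      ∫ q in (0 : ℝ)..t, (t - q) ^ (γ - 1) • B (y q) := fun t ht =>
    eq_fractionalIntegral_of_caputo hγ (hy.mono Ico_subset_Icc_self) hy0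
      (B.continuous.comp_continuousOn (hy.mono Ico_subset_Icc_self)) hcap ht
  -- Iterating the Volterra equation bounds `y` by `M` times the general term of a convergent
  -- Mittag-Leffler series, which tends to `0`.
  have hiter : ∀ k : ℕ, ∀ t ∈ Ioo 0 T,
      ‖y t‖ ≤ M * (‖B‖ ^ k * t ^ (γ * k) / Real.Gamma (γ * k + 1)) := by
    intro k
    induction k with
    | zero =>
      intro t ht
      simpa using hM t (Ioo_subset_Icc_self ht)
    | succ k ih =>
      intro t ht
      have hk : 0 < γ * k + 1 := by have := hγ.1; positivity
      have hGk := Real.Gamma_pos_of_pos hk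
      have h1 := congrArg norm (hvolt t ht)
      rw [norm_smul, Real.norm_of_nonneg hG.le] at h1
      have h2 : ‖∫ q in (0 : ℝ)..t, (t - q) ^ (γ - 1) • B (y q)‖ ≤
          ∫ q in (0 : ℝ)..t, (M * ‖B‖ ^ (k + 1) / Real.Gamma (γ * k + 1)) *
            ((t - q) ^ (γ - 1) * q ^ (γ * k + 1 - 1)) := by
        refine intervalIntegral.norm_integral_le_of_norm_le ht.1.le ?_
          ((intervalIntegrable_sub_rpow_mul_rpow hγ.1 hk ht.1).const_mul _)
        refine ae_of_all _ fun q hq => ?_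
        have hp : 0 ≤ (t - q) ^ (γ - 1) := Real.rpow_nonneg (sub_nonneg.2 hq.2) _
        rw [norm_smul, Real.norm_of_nonneg hp]
        calc (t - q) ^ (γ - 1) * ‖B (y q)‖
            ≤ (t - q) ^ (γ - 1) * (‖B‖ * (M * (‖B‖ ^ k * q ^ (γ * k) /
                Real.Gamma (γ * k + 1)))) := by
              gcongr
              exact B.le_opNorm_of_le (ih q ⟨hq.1, hq.2.trans_lt ht.2⟩)
          _ = _ := by rw [add_sub_cancel_right, pow_succ]; ring
      rw [intervalIntegral.integral_const_mul, integral_sub_rpow_mul_rpow hγ.1 hk ht.1, ← h1] at h2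
      rw [← mul_le_mul_iff_right₀ hG]
      refine h2.trans_eq ?_
      push_cast
      rw [show γ + (γ * k + 1) = γ * (k + 1) + 1 by ring, add_sub_cancel_right]
      field_simp
  have hIoo : ∀ t ∈ Ioo 0 T, y t = 0 := by
    intro t ht
    have hs := (summable_mittagLeffler hγ.1 one_pos (‖B‖ * t ^ γ)).tendsto_atTop_zero.const_mul M
    rw [mul_zero] at hs
    refine norm_le_zero_iff.1 (ge_of_tendsto' hs fun k => (hiter k t ht).trans_eq ?_)
    rw [mul_pow, Real.rpow_mul ht.1.le, Real.rpow_natCast]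
  intro t ht
  have hcl : t ∈ closure (Ioo 0 T) := by rwa [closure_Ioo hT.ne]
  have hy' : ContinuousOn y (closure (Ioo 0 T)) := by rwa [closure_Ioo hT.ne]
  exact EqOn.of_subset_closure (g := fun _ => (0 : E)) hIoo hy' continuousOn_const
    subset_closure le_rfl hcl

end Abstract

/-! ### Multiplication operators on `L²` -/

variable {n : ℕ}

/-- Bounded measurable multipliers. -/
def IsMultiplier (m : EuclideanSpace ℝ (Fin n) → ℝ) : Prop :=
  Measurable m ∧ ∃ C, ∀ x, |m x| ≤ C

theorem IsMultiplier.memLp {m : EuclideanSpace ℝ (Fin n) → ℝ} (hm : IsMultiplier m) (f : L2 n) :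
    MemLp (fun x => (m x : ℂ) * f x) 2 volume := by
  obtain ⟨C, hC⟩ := hm.2
  refine (Lp.memLp f).of_le_mul (c := C)
    ((Complex.measurable_ofReal.comp hm.1).aestronglyMeasurable.mul (Lp.aestronglyMeasurable f)) ?_
  refine ae_of_all _ fun x => ?_
  rw [norm_mul, Complex.norm_real]
  exact mul_le_mul_of_nonneg_right (hC x) (norm_nonneg _)

/-- Multiplication by a bounded measurable function as an operator on `L²`
(zero if the function is not bounded and measurable). -/
def mulOp (m : EuclideanSpace ℝ (Fin n) → ℝ) : L2 n →L[ℂ] L2 n := by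
  classical
  exact if hm : IsMultiplier m then
    LinearMap.mkContinuous
      { toFun := fun f => (hm.memLp f).toLp
        map_add' := fun f g => by
          rw [← MemLp.toLp_add]
          refine MemLp.toLp_congr _ _ ?_
          filter_upwards [Lp.coeFn_add f g] with x hx
          simp only [hx, Pi.add_apply, mul_add]
        map_smul' := fun c f => by
          rw [RingHom.id_apply, ← MemLp.toLp_const_smul]
          refine MemLp.toLp_congr _ _ ?_
          filter_upwards [Lp.coeFn_smul c f] with x hx
          simp only [hx, Pi.smul_apply, smul_eq_mul]
          ring }
      hm.2.choose fun f => by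
        refine Lp.norm_le_mul_norm_of_ae_le_mul ?_
        filter_upwards [(hm.memLp f).coeFn_toLp] with x hx
        simp only [LinearMap.coe_mk, AddHom.coe_mk]
        rw [hx, norm_mul, Complex.norm_real]
        exact mul_le_mul_of_nonneg_right (hm.2.choose_spec x) (norm_nonneg _)
  else 0

theorem coeFn_mulOp {m : EuclideanSpace ℝ (Fin n) → ℝ} (hm : IsMultiplier m) (f : L2 n) :
    mulOp m f =ᵐ[volume] fun x => (m x : ℂ) * f x := by
  rw [mulOp, dif_pos hm]
  exact (hm.memLp f).coeFn_toLp

theorem norm_mulOp_apply_le {m : EuclideanSpace ℝ (Fin n) → ℝ} (hm : IsMultiplier m) {C : ℝ}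
    (hC : ∀ x, |m x| ≤ C) (f : L2 n) : ‖mulOp m f‖ ≤ C * ‖f‖ := by
  refine Lp.norm_le_mul_norm_of_ae_le_mul ?_
  filter_upwards [coeFn_mulOp hm f] with x hx
  rw [hx, norm_mul, Complex.norm_real]
  exact mul_le_mul_of_nonneg_right (hC x) (norm_nonneg _)

theorem tendsto_Lp_of_dominated {ι : Type*} {l : Filter ι} [l.IsCountablyGenerated]
    {F : ι → L2 n} {f : L2 n} {Φ : ι → EuclideanSpace ℝ (Fin n) → ℂ}
    {φ : EuclideanSpace ℝ (Fin n) → ℂ} {G : EuclideanSpace ℝ (Fin n) → ℝ}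
    (hF : ∀ᶠ i in l, F i =ᵐ[volume] Φ i) (hf : f =ᵐ[volume] φ) (hG : MemLp G 2 volume)
    (hbound : ∀ᶠ i in l, ∀ᵐ x ∂volume, ‖Φ i x - φ x‖ ≤ G x)
    (hlim : ∀ᵐ x ∂volume, Tendsto (fun i => Φ i x) l (𝓝 (φ x))) :
    Tendsto F l (𝓝 f) := by
  rw [Lp.tendsto_Lp_iff_tendsto_eLpNorm']
  have h2 : (2 : ℝ≥0∞) ≠ 0 := by norm_num
  have h2' : (2 : ℝ≥0∞) ≠ ∞ := by norm_num
  have key : Tendsto (fun i => ∫⁻ x, ‖(F i : EuclideanSpace ℝ (Fin n) → ℂ) x - f x‖ₑ ^ (2 : ℝ))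
      l (𝓝 (∫⁻ _ : EuclideanSpace ℝ (Fin n), 0)) := by
    have hΦ : ∀ᶠ i in l, ∫⁻ x, ‖Φ i x - φ x‖ₑ ^ (2 : ℝ) =
        ∫⁻ x, ‖(F i : EuclideanSpace ℝ (Fin n) → ℂ) x - f x‖ₑ ^ (2 : ℝ) := by
      filter_upwards [hF] with i hi
      refine lintegral_congr_ae ?_
      filter_upwards [hi, hf] with x h1 h2
      simp only [h1, h2]
    refine Tendsto.congr' hΦ ?_
    refine tendsto_lintegral_filter_of_dominated_convergence' (fun x => ‖G x‖ₑ ^ (2 : ℝ))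
      ?_ ?_ ?_ ?_
    · filter_upwards [hF] with i hi
      have h1 : AEStronglyMeasurable (Φ i) volume := (Lp.aestronglyMeasurable (F i)).congr hi
      have h2 : AEStronglyMeasurable φ volume := (Lp.aestronglyMeasurable f).congr hf
      exact (h1.sub h2).enorm.pow_const _
    · filter_upwards [hbound] with i hi
      filter_upwards [hi] with x hx
      gcongr
      rw [← ofReal_norm, ← ofReal_norm]
      exact ENNReal.ofReal_le_ofReal (hx.trans (le_abs_self _))
    · have := hG.eLpNorm_lt_top
      rw [eLpNorm_lt_top_iff_lintegral_rpow_enorm_lt_top h2 h2'] at this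
      simpa using this.ne
    · filter_upwards [hlim] with x hx
      have h := (hx.sub_const (φ x)).enorm.ennrpow_const 2
      simpa using h
  rw [lintegral_zero] at key
  have h := key.ennrpow_const (1 / 2)
  rw [ENNReal.zero_rpow_of_pos (by norm_num)] at h
  refine h.congr fun i => ?_
  rw [eLpNorm_eq_lintegral_rpow_enorm_toReal h2 h2']
  simp

/-- Uniformly bounded, pointwise convergent symbols give strongly convergent operators, though in
general not norm convergent ones. -/
theorem tendsto_mulOp {ι : Type*} {l : Filter ι} [l.IsCountablyGenerated]
    {m : ι → EuclideanSpace ℝ (Fin n) → ℝ} {m₀ : EuclideanSpace ℝ (Fin n) → ℝ} {C : ℝ}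
    (hm : ∀ᶠ i in l, Measurable (m i) ∧ ∀ x, |m i x| ≤ C) (hm₀ : Measurable m₀)
    (hC : ∀ x, |m₀ x| ≤ C) (hlim : ∀ x, Tendsto (fun i => m i x) l (𝓝 (m₀ x))) (f : L2 n) :
    Tendsto (fun i => mulOp (m i) f) l (𝓝 (mulOp m₀ f)) := by
  refine tendsto_Lp_of_dominated (Φ := fun i x => (m i x : ℂ) * f x)
    (G := fun x => 2 * C * ‖f x‖)
    (hm.mono fun i hi => coeFn_mulOp ⟨hi.1, C, hi.2⟩ f) (coeFn_mulOp ⟨hm₀, C, hC⟩ f)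
    ((Lp.memLp f).norm.const_mul _) ?_ ?_
  · filter_upwards [hm] with i hi
    refine ae_of_all _ fun x => ?_
    rw [← sub_mul, norm_mul]
    refine mul_le_mul_of_nonneg_right ?_ (norm_nonneg _)
    rw [← Complex.ofReal_sub, Complex.norm_real, Real.norm_eq_abs]
    exact (abs_sub _ _).trans (by linarith [hi.2 x, hC x])
  · refine ae_of_all _ fun x => ?_
    exact ((Complex.continuous_ofReal.tendsto _).comp (hlim x)).mul_const _

/-! ### The evolution operators on the Fourier side -/

/-- The symbol `(2π‖η‖)²` of `-Δ`. -/
def symb (η : EuclideanSpace ℝ (Fin n)) : ℝ := (2 * Real.pi * ‖η‖) ^ 2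

theorem symb_nonneg (η : EuclideanSpace ℝ (Fin n)) : 0 ≤ symb η := sq_nonneg _

theorem continuous_symb : Continuous (symb (n := n)) := by
  unfold symb
  fun_prop

/-- Multiplication by `E_γ(-(2π‖η‖)² t ^ γ)`. -/
def relaxOp (n : ℕ) (γ t : ℝ) : L2 n →L[ℂ] L2 n := mulOp fun η => relax γ (symb η) t

/-- Multiplication by `t ^ (γ - 1) E_{γ,γ}(-(2π‖η‖)² t ^ γ)`. -/
def relaxKerOp (n : ℕ) (γ t : ℝ) : L2 n →L[ℂ] L2 n := mulOp fun η => relaxKer γ (symb η) t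

theorem measurable_relax_symb {γ : ℝ} (hγ : 0 < γ) (t : ℝ) :
    Measurable fun η : EuclideanSpace ℝ (Fin n) => relax γ (symb η) t :=
  ((continuous_relax_left hγ t).comp continuous_symb).measurable

theorem measurable_relaxKer_symb {γ : ℝ} (hγ : 0 < γ) (t : ℝ) :
    Measurable fun η : EuclideanSpace ℝ (Fin n) => relaxKer γ (symb η) t :=
  (measurable_relaxKer hγ).comp (continuous_symb.measurable.prodMk measurable_const)

theorem abs_relax_le_one {γ μ t : ℝ} (hγ : γ ∈ Ioo (0 : ℝ) 1) (hμ : 0 ≤ μ) (ht : 0 ≤ t) :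
    |relax γ μ t| ≤ 1 := by
  rw [abs_of_pos (relax_pos hγ hμ ht)]
  exact relax_le_one hγ hμ ht

theorem abs_relaxKer_le {γ μ t : ℝ} (hγ : γ ∈ Ioo (0 : ℝ) 1) (hμ : 0 ≤ μ) (ht : 0 < t) :
    |relaxKer γ μ t| ≤ t ^ (γ - 1) / Real.Gamma γ := by
  rw [abs_of_nonneg (relaxKer_nonneg hγ hμ ht)]
  exact relaxKer_le hγ hμ ht

theorem isMultiplier_relax {γ t : ℝ} (hγ : γ ∈ Ioo (0 : ℝ) 1) (ht : 0 ≤ t) :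
    IsMultiplier fun η : EuclideanSpace ℝ (Fin n) => relax γ (symb η) t :=
  ⟨measurable_relax_symb hγ.1 t, 1, fun η => abs_relax_le_one hγ (symb_nonneg η) ht⟩

theorem isMultiplier_relaxKer {γ t : ℝ} (hγ : γ ∈ Ioo (0 : ℝ) 1) (ht : 0 < t) :
    IsMultiplier fun η : EuclideanSpace ℝ (Fin n) => relaxKer γ (symb η) t :=
  ⟨measurable_relaxKer_symb hγ.1 t, _, fun η => abs_relaxKer_le hγ (symb_nonneg η) ht⟩

theorem relaxOp_zero {γ : ℝ} (hγ : γ ∈ Ioo (0 : ℝ) 1) (f : L2 n) : relaxOp n γ 0 f = f := by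
  refine Lp.ext ?_
  filter_upwards [coeFn_mulOp (isMultiplier_relax hγ le_rfl) f] with x hx
  rw [relaxOp, hx, relax_zero_right hγ.1]
  simp

theorem continuousOn_relaxOp {γ : ℝ} (hγ : γ ∈ Ioo (0 : ℝ) 1) (f : L2 n) :
    ContinuousOn (fun t => relaxOp n γ t f) (Ici 0) := by
  intro t ht
  refine tendsto_mulOp (C := 1) ?_ (measurable_relax_symb hγ.1 t)
    (fun η => abs_relax_le_one hγ (symb_nonneg η) ht) (fun η => ?_) f
  · filter_upwards [self_mem_nhdsWithin] with r hr
    exact ⟨measurable_relax_symb hγ.1 r, fun η => abs_relax_le_one hγ (symb_nonneg η) hr⟩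
  · exact (continuous_relax hγ.1 _).continuousWithinAt

theorem rpow_div_Gamma_le_of_half_lt {γ t : ℝ} (hγ : γ ∈ Ioo (0 : ℝ) 1) (ht : 0 < t) {r : ℝ}
    (hr : t / 2 < r) : r ^ (γ - 1) / Real.Gamma γ ≤ (t / 2) ^ (γ - 1) / Real.Gamma γ := by
  have := Real.Gamma_pos_of_pos hγ.1
  gcongr ?_ / _
  exact Real.rpow_le_rpow_of_nonpos (by linarith) hr.le (by linarith [hγ.2])

theorem continuousOn_relaxKerOp {γ : ℝ} (hγ : γ ∈ Ioo (0 : ℝ) 1) (f : L2 n) :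
    ContinuousOn (fun t => relaxKerOp n γ t f) (Ioi 0) := by
  intro t ht
  have ht' : 0 < t := ht
  refine tendsto_mulOp (C := (t / 2) ^ (γ - 1) / Real.Gamma γ) ?_ (measurable_relaxKer_symb hγ.1 t)
    (fun η => (abs_relaxKer_le hγ (symb_nonneg η) ht).trans
      (rpow_div_Gamma_le_of_half_lt hγ ht' (by linarith))) (fun η => ?_) f
  · filter_upwards [nhdsWithin_le_nhds (Ioi_mem_nhds (show t / 2 < t by linarith))] with r hr
    have hr0 : 0 < r := (half_pos ht').trans hr
    exact ⟨measurable_relaxKer_symb hγ.1 r, fun η =>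
      (abs_relaxKer_le hγ (symb_nonneg η) hr0).trans (rpow_div_Gamma_le_of_half_lt hγ ht' hr)⟩
  · exact (continuousOn_relaxKer hγ.1 _) t ht

/-- For `r > t/2` the mean value inequality bounds the difference quotients of the symbol by `symb η
* C`, with `C` independent of `η`. As `symb * f = g` lies in `L²`, dominated convergence applies. -/
theorem hasDerivAt_relaxOp {γ t : ℝ} (hγ : γ ∈ Ioo (0 : ℝ) 1) (ht : 0 < t) {f g : L2 n}
    (hfg : g =ᵐ[volume] fun η => (symb η : ℂ) * f η) :
    HasDerivAt (fun t => relaxOp n γ t f) (-relaxKerOp n γ t g) t := by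
  rw [hasDerivAt_iff_tendsto_slope]
  set C := (t / 2) ^ (γ - 1) / Real.Gamma γ with hCdef
  refine tendsto_Lp_of_dominated (G := fun η => 2 * C * ‖g η‖)
    (Φ := fun r η => ((slope (relax γ (symb η)) t r : ℝ) : ℂ) * f η)
    (φ := fun η => ((-symb η * relaxKer γ (symb η) t : ℝ) : ℂ) * f η) ?_ ?_
    ((Lp.memLp g).norm.const_mul _) ?_ ?_
  · filter_upwards [nhdsWithin_le_nhds (Ioi_mem_nhds ht)] with r hr
    have h1 := coeFn_mulOp (isMultiplier_relax (n := n) hγ (le_of_lt hr)) f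
    have h2 := coeFn_mulOp (isMultiplier_relax (n := n) hγ ht.le) f
    rw [slope_def_module]
    filter_upwards [h1, h2, Lp.coeFn_smul (r - t)⁻¹ (relaxOp n γ r f - relaxOp n γ t f),
      Lp.coeFn_sub (relaxOp n γ r f) (relaxOp n γ t f)] with η h1 h2 h3 h4
    rw [h3, Pi.smul_apply, h4, Pi.sub_apply, relaxOp, relaxOp, h1, h2, slope_def_field,
      Complex.real_smul]
    push_cast
    ring
  · filter_upwards [hfg, Lp.coeFn_neg (relaxKerOp n γ t g),
      coeFn_mulOp (isMultiplier_relaxKer hγ ht) g] with η h1 h2 h3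
    rw [h2, Pi.neg_apply, relaxKerOp, h3, h1]
    push_cast
    ring
  · filter_upwards [nhdsWithin_le_nhds (Ioi_mem_nhds (show t / 2 < t by linarith)),
      self_mem_nhdsWithin] with r hr hrt
    filter_upwards [hfg] with η hη
    have hder : ∀ p ∈ Ioi (t / 2), HasDerivWithinAt (relax γ (symb η))
        (-symb η * relaxKer γ (symb η) p) (Ioi (t / 2)) p := fun p hp =>
      (hasDerivAt_relax hγ.1 _ ((half_pos ht).trans hp)).hasDerivWithinAt
    have hb : ∀ p ∈ Ioi (t / 2), ‖-symb η * relaxKer γ (symb η) p‖ ≤ symb η * C := fun p hp => by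
      rw [norm_mul, norm_neg, Real.norm_of_nonneg (symb_nonneg η)]
      exact mul_le_mul_of_nonneg_left ((abs_relaxKer_le hγ (symb_nonneg η)
        ((half_pos ht).trans hp)).trans (rpow_div_Gamma_le_of_half_lt hγ ht hp)) (symb_nonneg η)
    have htm : t ∈ Ioi (t / 2) := by simp only [mem_Ioi]; linarith
    have hmv := (convex_Ioi (t / 2)).norm_image_sub_le_of_norm_hasDerivWithin_le hder hb htm hr
    have hs : ‖slope (relax γ (symb η)) t r‖ ≤ symb η * C := by
      rw [slope_def_field, norm_div, div_le_iff₀ (norm_pos_iff.2 (sub_ne_zero.2 hrt))]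
      exact hmv
    rw [← sub_mul, ← Complex.ofReal_sub, norm_mul, Complex.norm_real, hη, norm_mul,
      Complex.norm_real, Real.norm_of_nonneg (symb_nonneg η)]
    calc _ ≤ (symb η * C + symb η * C) * ‖f η‖ := by
          gcongr
          exact (norm_sub_le _ _).trans (add_le_add hs (hb t htm))
      _ = _ := by ring
  · refine ae_of_all _ fun η => ?_
    have := hasDerivAt_iff_tendsto_slope.1 (hasDerivAt_relax hγ.1 (symb η) ht)
    exact ((Complex.continuous_ofReal.tendsto _).comp this).mul_const _

theorem intervalIntegrable_relaxKerOp {γ t : ℝ} (hγ : γ ∈ Ioo (0 : ℝ) 1) (ht : 0 < t) (g : L2 n) :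
    IntervalIntegrable (fun r => (t - r) ^ (-γ) • relaxKerOp n γ r g) volume 0 t := by
  have hb := intervalIntegrable_sub_rpow_mul_rpow (sub_pos.2 hγ.2) hγ.1 ht
  rw [intervalIntegrable_iff_integrableOn_Ioo_of_le ht.le] at hb ⊢
  refine Integrable.mono' (hb.const_mul (‖g‖ / Real.Gamma γ)) ?_ ?_
  · refine ContinuousOn.aestronglyMeasurable ?_ measurableSet_Ioo
    exact ((continuousOn_sub_rpow t _).mono fun r hr => hr.2).smul
      ((continuousOn_relaxKerOp hγ g).mono fun r hr => hr.1)
  · filter_upwards [ae_restrict_mem measurableSet_Ioo] with r hr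
    have h1 : 0 ≤ (t - r) ^ (-γ) := Real.rpow_nonneg (sub_pos.2 hr.2).le _
    have h2 := norm_mulOp_apply_le (isMultiplier_relaxKer (n := n) hγ hr.1)
      (fun η => abs_relaxKer_le hγ (symb_nonneg η) hr.1) g
    rw [norm_smul, Real.norm_of_nonneg h1]
    calc _ ≤ (t - r) ^ (-γ) * (r ^ (γ - 1) / Real.Gamma γ * ‖g‖) := by
          gcongr
          exact h2
      _ = _ := by rw [show 1 - γ - 1 = -γ by ring]; ring

theorem integral_relaxKerOp {γ t : ℝ} (hγ : γ ∈ Ioo (0 : ℝ) 1) (ht : 0 < t) (g : L2 n) :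
    ∫ r in (0 : ℝ)..t, (t - r) ^ (-γ) • relaxKerOp n γ r g =
      Real.Gamma (1 - γ) • relaxOp n γ t g := by
  -- Testing against `ψ` turns the vector-valued integral into a double integral; Fubini then
  -- reduces it to the scalar identity at each frequency.
  refine ext_inner_left ℂ fun ψ => ?_
  have hint := intervalIntegrable_relaxKerOp hγ ht g
  have h1 : inner ℂ ψ (∫ r in (0 : ℝ)..t, (t - r) ^ (-γ) • relaxKerOp n γ r g) =
      ∫ r in (0 : ℝ)..t, inner ℂ ψ ((t - r) ^ (-γ) • relaxKerOp n γ r g) :=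
    ((innerSL ℂ ψ).intervalIntegral_comp_comm hint).symm
  set H : EuclideanSpace ℝ (Fin n) → ℂ := fun η => inner ℂ (ψ η) (g η) with hHdef
  have hH : Integrable H volume := L2.integrable_inner ψ g
  set ν : Measure ℝ := volume.restrict (Ioo 0 t) with hν
  set J : ℝ → EuclideanSpace ℝ (Fin n) → ℂ := fun r η =>
    (((t - r) ^ (-γ) * relaxKer γ (symb η) r : ℝ) : ℂ) * H η with hJdef
  have h2 : ∀ r ∈ Ioo 0 t, inner ℂ ψ ((t - r) ^ (-γ) • relaxKerOp n γ r g) = ∫ η, J r η := by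
    intro r hr
    rw [L2.inner_def]
    refine integral_congr_ae ?_
    filter_upwards [Lp.coeFn_smul ((t - r) ^ (-γ)) (relaxKerOp n γ r g),
      coeFn_mulOp (isMultiplier_relaxKer hγ hr.1) g] with η h3 h4
    rw [h3, Pi.smul_apply, relaxKerOp, h4]
    simp only [hJdef, hHdef, Complex.real_smul, RCLike.inner_apply]
    push_cast
    ring
  have h3 : inner ℂ ψ (Real.Gamma (1 - γ) • relaxOp n γ t g) =
      ∫ η, ((Real.Gamma (1 - γ) * relax γ (symb η) t : ℝ) : ℂ) * H η := by
    rw [L2.inner_def]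
    refine integral_congr_ae ?_
    filter_upwards [Lp.coeFn_smul (Real.Gamma (1 - γ)) (relaxOp n γ t g),
      coeFn_mulOp (isMultiplier_relax hγ ht.le) g] with η h3 h4
    rw [h3, Pi.smul_apply, relaxOp, h4]
    simp only [hHdef, Complex.real_smul, RCLike.inner_apply]
    push_cast
    ring
  have hJ : Integrable (Function.uncurry J) (ν.prod volume) := by
    have hb := intervalIntegrable_sub_rpow_mul_rpow (sub_pos.2 hγ.2) hγ.1 ht
    rw [intervalIntegrable_iff_integrableOn_Ioo_of_le ht.le] at hb
    have hdom := (Integrable.div_const (μ := ν) hb (Real.Gamma γ)).mul_prod (ν := volume) hH.norm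
    refine Integrable.mono' hdom ?_ ?_
    · refine AEStronglyMeasurable.mul ?_ (hH.1.comp_snd (μ := ν))
      refine Measurable.aestronglyMeasurable ?_
      refine Complex.measurable_ofReal.comp (Measurable.mul (by fun_prop) ?_)
      exact (measurable_relaxKer hγ.1).comp
        ((continuous_symb.measurable.comp measurable_snd).prodMk measurable_fst)
    · have : ∀ᵐ p ∂(ν.prod (volume : Measure (EuclideanSpace ℝ (Fin n)))), p.1 ∈ Ioo 0 t :=
        Measure.quasiMeasurePreserving_fst.ae (ae_restrict_mem measurableSet_Ioo)
      filter_upwards [this] with p hp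
      have h4 : 0 ≤ (t - p.1) ^ (-γ) := Real.rpow_nonneg (sub_pos.2 hp.2).le _
      simp only [Function.uncurry, hJdef]
      rw [norm_mul, Complex.norm_real, norm_mul, Real.norm_of_nonneg h4,
        show 1 - γ - 1 = -γ by ring, mul_div_assoc]
      gcongr
      exact abs_relaxKer_le hγ (symb_nonneg _) hp.1
  rw [h1, h3, intervalIntegral.integral_of_le ht.le, ← restrict_Ioo_eq_restrict_Ioc,
    setIntegral_congr_fun measurableSet_Ioo h2, integral_integral_swap hJ]
  refine integral_congr_ae (ae_of_all _ fun η => ?_)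
  simp only [hJdef]
  rw [integral_mul_const, integral_complex_ofReal, hν, restrict_Ioo_eq_restrict_Ioc,
    ← intervalIntegral.integral_of_le ht.le, (integral_rpow_mul_relaxKer hγ _ ht).2]

theorem hasCaputoDerivAt_relaxOp {γ t : ℝ} (hγ : γ ∈ Ioo (0 : ℝ) 1) (ht : 0 < t) {f g : L2 n}
    (hfg : g =ᵐ[volume] fun η => (symb η : ℂ) * f η) :
    HasCaputoDerivAt γ (fun t => relaxOp n γ t f) (-relaxOp n γ t g) t := by
  have hder : ∀ r, 0 < r → HasDerivAt (fun t => relaxOp n γ t f) (-relaxKerOp n γ r g) r :=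
    fun r hr => hasDerivAt_relaxOp hγ hr hfg
  have hint := intervalIntegrable_relaxKerOp hγ ht g
  have hfun : ∀ ε ∈ Ioo 0 t, EqOn (fun r => (t - r) ^ (-γ) • deriv (fun t => relaxOp n γ t f) r)
      (fun r => -((t - r) ^ (-γ) • relaxKerOp n γ r g)) (uIcc ε t) := by
    intro ε hε r hr
    rw [uIcc_of_le hε.2.le] at hr
    simp only [(hder r (hε.1.trans_le hr.1)).deriv, smul_neg]
  refine ⟨fun r hr => (hder r hr.1).differentiableAt, fun ε hε => ?_, ?_⟩
  · refine (intervalIntegrable_congr ((hfun ε hε).mono uIoc_subset_uIcc)).2 ?_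
    refine (hint.mono_set ?_).neg
    rw [uIcc_of_le hε.2.le, uIcc_of_le ht.le]
    exact Icc_subset_Icc_left hε.1.le
  · have h := intervalIntegral.continuousOn_primitive_interval' hint right_mem_uIcc 0
      left_mem_uIcc
    rw [uIcc_of_le ht.le] at h
    have h' := (h.tendsto.mono_left (nhdsWithin_le_of_mem (Icc_mem_nhdsGT ht))).const_smul
      (Real.Gamma (1 - γ))⁻¹
    rw [intervalIntegral.integral_symm, integral_relaxKerOp hγ ht, smul_neg, smul_smul,
      inv_mul_cancel₀ (Real.Gamma_pos_of_pos (sub_pos.2 hγ.2)).ne', one_smul] at h'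
    refine h'.congr' ?_
    filter_upwards [Ioo_mem_nhdsGT ht] with ε hε
    rw [intervalIntegral.integral_congr (hfun ε hε), intervalIntegral.integral_neg,
      intervalIntegral.integral_symm]

/-! ### The Fourier transform of `L¹ ∩ L²` functions, the Laplacian, and Sobolev spaces -/

theorem ae_eq_of_forall_schwartz {f g : EuclideanSpace ℝ (Fin n) → ℂ}
    (hf : LocallyIntegrable f volume) (hg : LocallyIntegrable g volume)
    (h : ∀ ψ : 𝓢(EuclideanSpace ℝ (Fin n), ℂ), ∫ x, ψ x * f x = ∫ x, ψ x * g x) :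
    f =ᵐ[volume] g := by
  refine ae_eq_of_integral_contDiff_smul_eq hf hg fun k hk hkc => ?_
  have h₁ : HasCompactSupport (Complex.ofRealCLM ∘ k) := hkc.comp_left rfl
  have h₂ : ContDiff ℝ ((⊤ : ℕ∞) : WithTop ℕ∞) (Complex.ofRealCLM ∘ k) :=
    Complex.ofRealCLM.contDiff.comp hk
  simpa using h (h₁.toSchwartzMap h₂)

theorem locallyIntegrable_coeFn (f : L2 n) : LocallyIntegrable f volume :=
  (Lp.memLp f).locallyIntegrable (by norm_num)

theorem continuous_fourierInv {f : EuclideanSpace ℝ (Fin n) → ℂ} (hf : Integrable f) :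
    Continuous (𝓕⁻ f : EuclideanSpace ℝ (Fin n) → ℂ) :=
  VectorFourier.fourierIntegral_continuous Real.continuous_fourierChar
    (by simp only [LinearMap.neg_apply, innerₗ_apply_apply]; fun_prop) hf

/-- Identifies the `L²` inverse transform with the integral formula on `L¹ ∩ L²`: both are dual to
the inverse transform of Schwartz functions. -/
theorem fourierInv_ae_eq {f : EuclideanSpace ℝ (Fin n) → ℂ} (hf : Integrable f) {h : L2 n}
    (hh : h =ᵐ[volume] f) :
    (𝓕⁻ h : L2 n) =ᵐ[volume] (𝓕⁻ f : EuclideanSpace ℝ (Fin n) → ℂ) := by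
  refine ae_eq_of_forall_schwartz (locallyIntegrable_coeFn _)
    (continuous_fourierInv hf).locallyIntegrable fun ψ => ?_
  have h1 : ∫ x, ψ x * (𝓕⁻ h : L2 n) x = ∫ x, (𝓕⁻ ψ) x * h x := by
    have := congrArg (fun u : 𝓢'(EuclideanSpace ℝ (Fin n), ℂ) => u ψ)
      (Lp.fourierInv_toTemperedDistribution_eq h)
    simp only [TemperedDistribution.fourierInv_apply, Lp.toTemperedDistribution_apply,
      smul_eq_mul] at this
    exact this.symm
  have h2 : ∫ x, (𝓕⁻ ψ) x * h x = ∫ x, (𝓕⁻ (ψ : EuclideanSpace ℝ (Fin n) → ℂ)) x * f x := by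
    refine integral_congr_ae ?_
    filter_upwards [hh] with x hx
    rw [hx, SchwartzMap.fourierInv_coe]
  have hflip : (-innerₗ (EuclideanSpace ℝ (Fin n))).flip = -innerₗ (EuclideanSpace ℝ (Fin n)) := by
    ext x y
    simp [real_inner_comm]
  have h3 := VectorFourier.integral_fourierIntegral_smul_eq_flip
    (L := -innerₗ (EuclideanSpace ℝ (Fin n))) (μ := volume) (ν := volume)
    Real.continuous_fourierChar
    (by simp only [LinearMap.neg_apply, innerₗ_apply_apply]; fun_prop) ψ.integrable hf
  rw [hflip] at h3
  rw [h1, h2]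
  exact h3

theorem smulLeftCLM_eq_iff {k : EuclideanSpace ℝ (Fin n) → ℂ} (hk : k.HasTemperateGrowth)
    (w v : L2 n) :
    TemperedDistribution.smulLeftCLM ℂ k (w : 𝓢'(EuclideanSpace ℝ (Fin n), ℂ)) = v ↔
      v =ᵐ[volume] fun x => k x * w x := by
  have hw : ∀ ψ : 𝓢(EuclideanSpace ℝ (Fin n), ℂ),
      TemperedDistribution.smulLeftCLM ℂ k (w : 𝓢'(EuclideanSpace ℝ (Fin n), ℂ)) ψ =
        ∫ x, ψ x * (k x * w x) := fun ψ => by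
    rw [TemperedDistribution.smulLeftCLM_apply_apply, Lp.toTemperedDistribution_apply]
    refine integral_congr_ae (ae_of_all _ fun x => ?_)
    simp only [SchwartzMap.smulLeftCLM_apply_apply hk, smul_eq_mul]
    ring
  have hv : ∀ ψ : 𝓢(EuclideanSpace ℝ (Fin n), ℂ),
      (v : 𝓢'(EuclideanSpace ℝ (Fin n), ℂ)) ψ = ∫ x, ψ x * v x := fun ψ => by
    simp [Lp.toTemperedDistribution_apply]
  constructor
  · intro h
    refine ae_eq_of_forall_schwartz (locallyIntegrable_coeFn _) ?_ fun ψ => ?_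
    · rw [← locallyIntegrableOn_univ]
      exact (locallyIntegrable_coeFn w).locallyIntegrableOn univ |>.continuousOn_mul
        hk.1.continuous.continuousOn isOpen_univ.isLocallyClosed
    · rw [← hw, h, hv]
  · intro h
    ext ψ
    rw [hw, hv]
    refine integral_congr_ae ?_
    filter_upwards [h] with x hx
    rw [hx]

theorem fourier_laplacian (f : 𝓢'(EuclideanSpace ℝ (Fin n), ℂ)) :
    𝓕 (Δ f) = TemperedDistribution.smulLeftCLM ℂ
      (fun η : EuclideanSpace ℝ (Fin n) => ((-symb η : ℝ) : ℂ)) (𝓕 f) := by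
  have hg : (fun x : EuclideanSpace ℝ (Fin n) => Complex.ofReal (‖x‖ ^ 2)).HasTemperateGrowth := by
    fun_prop
  rw [TemperedDistribution.laplacian_eq_fourierMultiplierCLM,
    ← Complex.coe_smul (-(2 * Real.pi) ^ 2), FourierTransform.fourier_smul,
    TemperedDistribution.fourierMultiplierCLM_apply, FourierTransform.fourier_fourierInv_eq,
    ← smul_apply, ← TemperedDistribution.smulLeftCLM_smul hg]
  congr 2
  funext x
  simp only [symb, Pi.smul_apply, smul_eq_mul]
  push_cast
  ring

theorem hasTemperateGrowth_symb :
    (fun η : EuclideanSpace ℝ (Fin n) => ((-symb η : ℝ) : ℂ)).HasTemperateGrowth := by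
  have : (fun η : EuclideanSpace ℝ (Fin n) => ((-symb η : ℝ) : ℂ)) =
      fun η => Complex.ofReal (-(2 * Real.pi) ^ 2 * ‖η‖ ^ 2) := by
    funext η
    simp only [symb]
    congr 1
    ring
  rw [this]
  fun_prop

theorem eq_laplacian_iff (u D : L2 n) :
    (D : 𝓢'(EuclideanSpace ℝ (Fin n), ℂ)) = Δ (u : 𝓢'(EuclideanSpace ℝ (Fin n), ℂ)) ↔
      (𝓕 D : L2 n) =ᵐ[volume] fun η => ((-symb η : ℝ) : ℂ) * (𝓕 u : L2 n) η := by
  rw [← smulLeftCLM_eq_iff hasTemperateGrowth_symb, ← Lp.fourier_toTemperedDistribution_eq,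
    ← Lp.fourier_toTemperedDistribution_eq, ← fourier_laplacian]
  constructor
  · intro h
    rw [h]
  · intro h
    have := congrArg (fun f : 𝓢'(EuclideanSpace ℝ (Fin n), ℂ) => 𝓕⁻ f) h
    simpa only [FourierTransform.fourierInv_fourier_eq] using this.symm

theorem memSobolev_two_of_ae_eq {u v : L2 n}
    (h : v =ᵐ[volume] fun η => (((1 + ‖η‖ ^ 2 : ℝ)) : ℂ) * (𝓕 u : L2 n) η) :
    TemperedDistribution.MemSobolev 2 2 (u : 𝓢'(EuclideanSpace ℝ (Fin n), ℂ)) := by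
  rw [TemperedDistribution.memSobolev_iff_exists_smulLeftCLM_fourier]
  refine ⟨v, ?_⟩
  rw [Lp.fourier_toTemperedDistribution_eq, smulLeftCLM_eq_iff ?_]
  · filter_upwards [h] with η hη
    rw [hη]
    norm_num
  · fun_prop

/-! ### The mollifier on the Fourier side -/

/-- For `x ≥ 1`, apply the `Γ` bound with `R = c x^s` and exponent `p/s`, so that `R^(p/s)` is a
multiple of `x^p`. -/
theorem one_add_rpow_mul_exp_le {p c s : ℝ} (hp : 0 ≤ p) (hc : 0 < c) (hs : 0 < s) :
    ∃ C > 0, ∀ x : ℝ, 0 ≤ x → (1 + x) ^ p * Real.exp (-(c * x ^ s)) ≤ C := by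
  have hG : 0 < Real.Gamma (p / s + 1) := Real.Gamma_pos_of_pos (by positivity)
  refine ⟨2 ^ p * (1 + c ^ (-(p / s)) * Real.Gamma (p / s + 1)), by positivity, fun x hx => ?_⟩
  rcases le_total x 1 with h | h
  · have h1 : (1 + x) ^ p ≤ 2 ^ p := Real.rpow_le_rpow (by positivity) (by linarith) hp
    have h2 : Real.exp (-(c * x ^ s)) ≤ 1 := Real.exp_le_one_iff.2 (by
      have : 0 ≤ x ^ s := Real.rpow_nonneg hx _
      nlinarith)
    calc _ ≤ (2 : ℝ) ^ p * 1 := by gcongr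
      _ ≤ _ := by
        gcongr
        have : 0 ≤ c ^ (-(p / s)) * Real.Gamma (p / s + 1) := by positivity
        linarith
  · have hx0 : 0 < x := by linarith
    have h1 : (1 + x) ^ p ≤ 2 ^ p * x ^ p := by
      rw [← Real.mul_rpow (by norm_num) hx]
      exact Real.rpow_le_rpow (by positivity) (by linarith) hp
    have h2 := rpow_mul_exp_neg_le_Gamma (R := c * x ^ s) (x := p / s) (by positivity)
      (by positivity)
    have h3 : (c * x ^ s) ^ (p / s) = c ^ (p / s) * x ^ p := by
      rw [Real.mul_rpow hc.le (by positivity), ← Real.rpow_mul hx, mul_div_cancel₀ _ hs.ne']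
    rw [h3] at h2
    calc _ ≤ (2 : ℝ) ^ p * x ^ p * Real.exp (-(c * x ^ s)) := by gcongr
      _ = 2 ^ p * (c ^ (-(p / s)) * (c ^ (p / s) * x ^ p * Real.exp (-(c * x ^ s)))) := by
        rw [Real.rpow_neg hc.le]
        field_simp
      _ ≤ 2 ^ p * (c ^ (-(p / s)) * Real.Gamma (p / s + 1)) := by gcongr
      _ ≤ _ := by gcongr; linarith

/-- The Fourier symbol `exp (-τ |α ξ|^s)`, `ξ = 2πη`, of the mollifier `M_α`. -/
def molSymb (τ s α : ℝ) (η : EuclideanSpace ℝ (Fin n)) : ℝ :=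
  Real.exp (-(τ * (α * (2 * Real.pi * ‖η‖)) ^ s))

theorem continuous_molSymb {τ s : ℝ} (hs : 0 < s) (α : ℝ) :
    Continuous (molSymb (n := n) τ s α) := by
  unfold molSymb
  exact Real.continuous_exp.comp (continuous_const.mul
    ((Real.continuous_rpow_const hs.le).comp (by fun_prop))).neg

theorem molSymb_pos (τ s α : ℝ) (η : EuclideanSpace ℝ (Fin n)) : 0 < molSymb τ s α η :=
  Real.exp_pos _

theorem molSymb_le_one {τ s α : ℝ} (hτ : 0 < τ) (hα : 0 ≤ α) (η : EuclideanSpace ℝ (Fin n)) :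
    molSymb τ s α η ≤ 1 :=
  Real.exp_le_one_iff.2 (neg_nonpos.2 (by positivity))

theorem one_add_norm_rpow_mul_molSymb_le {τ s α p : ℝ} (hτ : 0 < τ) (hs : 0 < s) (hα : 0 < α)
    (hp : 0 ≤ p) :
    ∃ C > 0, ∀ η : EuclideanSpace ℝ (Fin n), (1 + ‖η‖) ^ p * molSymb τ s α η ≤ C := by
  obtain ⟨C, hC, h⟩ := one_add_rpow_mul_exp_le (c := τ * (α * (2 * Real.pi)) ^ s) hp
    (by positivity) hs
  refine ⟨C, hC, fun η => ?_⟩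
  have := h ‖η‖ (norm_nonneg _)
  rwa [mul_assoc, ← Real.mul_rpow (by positivity) (norm_nonneg _), mul_assoc] at this

theorem integrable_molSymb {τ s α : ℝ} (hτ : 0 < τ) (hs : 0 < s) (hα : 0 < α) :
    Integrable (molSymb (n := n) τ s α) := by
  obtain ⟨C, hC, h⟩ := one_add_norm_rpow_mul_molSymb_le (n := n) (p := n + 1) hτ hs hα
    (by positivity)
  have hint : Integrable (fun x : EuclideanSpace ℝ (Fin n) => (1 + ‖x‖) ^ (-((n : ℝ) + 1))) :=
    integrable_one_add_norm (by simp)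
  refine Integrable.mono' (hint.const_mul C)
    (continuous_molSymb hs α).aestronglyMeasurable (ae_of_all _ fun η => ?_)
  rw [Real.norm_of_nonneg (molSymb_pos _ _ _ _).le, Real.rpow_neg (by positivity),
    ← div_eq_mul_inv, le_div_iff₀ (by positivity), mul_comm]
  exact h η

theorem memLp_molSymb {τ s α : ℝ} (hτ : 0 < τ) (hs : 0 < s) (hα : 0 < α) :
    MemLp (fun η : EuclideanSpace ℝ (Fin n) => (molSymb τ s α η : ℂ)) 2 volume := by
  suffices h2 : MemLp (molSymb (n := n) τ s α) 2 volume from h2.ofReal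
  rw [memLp_two_iff_integrable_sq (continuous_molSymb hs α).aestronglyMeasurable]
  -- Squaring the symbol doubles `τ`, so square integrability is integrability for `2τ`.
  have : (fun η : EuclideanSpace ℝ (Fin n) => molSymb τ s α η ^ 2) = molSymb (2 * τ) s α := by
    funext η
    rw [molSymb, molSymb, ← Real.exp_nat_mul]
    congr 1
    push_cast
    ring
  rw [this]
  exact integrable_molSymb (by positivity) hs hα

theorem isMultiplier_molSymb {τ s α : ℝ} (hτ : 0 < τ) (hs : 0 < s) (hα : 0 ≤ α) :
    IsMultiplier (molSymb (n := n) τ s α) :=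
  ⟨(continuous_molSymb hs α).measurable, 1, fun η => by
    rw [abs_of_pos (molSymb_pos _ _ _ _)]
    exact molSymb_le_one hτ hα η⟩

/-- Substitute `ξ = 2πα η`: the Jacobian absorbs both factors `(2π)^(-n/2)` and the factor `α^(-n)`.
-/
theorem scaledKernel_eq_fourierInv {τ s α : ℝ} (hα : 0 < α) (x : EuclideanSpace ℝ (Fin n)) :
    scaledKernel n τ s α x =
      (𝓕⁻ fun η : EuclideanSpace ℝ (Fin n) => (molSymb τ s α η : ℂ)) x := by
  have hR : 0 < 2 * Real.pi * α := by positivity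
  have h := Measure.integral_comp_smul (volume : Measure (EuclideanSpace ℝ (Fin n)))
    (fun ξ : EuclideanSpace ℝ (Fin n) => (Real.exp (-τ * ‖ξ‖ ^ s) : ℂ) *
      Complex.exp (Complex.I * (inner ℝ (α⁻¹ • x) ξ : ℝ))) (2 * Real.pi * α)
  have h1 : (𝓕⁻ fun η : EuclideanSpace ℝ (Fin n) => (molSymb τ s α η : ℂ)) x =
      ∫ η : EuclideanSpace ℝ (Fin n), (Real.exp (-τ * ‖(2 * Real.pi * α) • η‖ ^ s) : ℂ) *
        Complex.exp (Complex.I * (inner ℝ (α⁻¹ • x) ((2 * Real.pi * α) • η) : ℝ)) := by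
    rw [Real.fourierInv_eq']
    refine integral_congr_ae (ae_of_all _ fun η => ?_)
    simp only [molSymb, smul_eq_mul]
    rw [mul_comm, norm_smul, Real.norm_of_nonneg hR.le, real_inner_smul_left,
      real_inner_smul_right, real_inner_comm]
    congr 2
    · congr 1
      rw [neg_mul]
      ring_nf
    · have : α⁻¹ * (2 * Real.pi * α * inner ℝ x η) = 2 * Real.pi * inner ℝ x η := by
        field_simp
      rw [this, mul_comm]
  rw [h1, h, scaledKernel, kernel, unitaryFourierInv, finrank_euclideanSpace_fin,
    abs_of_pos (by positivity), Complex.real_smul, ← mul_assoc, ← mul_assoc]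
  congr 1
  have h2 : ((Real.sqrt (2 * Real.pi) : ℂ) ^ n)⁻¹ * ((Real.sqrt (2 * Real.pi) : ℂ) ^ n)⁻¹ =
      ((2 * Real.pi : ℂ) ^ n)⁻¹ := by
    rw [← mul_inv, ← mul_pow, ← Complex.ofReal_mul, Real.mul_self_sqrt (by positivity)]
    push_cast
    rfl
  rw [mul_assoc, h2, ← mul_inv, ← mul_pow]
  push_cast
  rw [mul_comm (α : ℂ)]

/-- At a fixed `x` the convolution is an `L²` pairing of `g` with the conjugate of `y ↦ φ_α(x - y)`,
which is the inverse transform of `ψ`; Parseval gives the formula at every point. Integrability of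
the kernel itself is not needed. -/
theorem mollify_eq_fourierInv {τ s α : ℝ} (hτ : 0 < τ) (hs : 0 < s) (hα : 0 < α) (g : L2 n)
    (x : EuclideanSpace ℝ (Fin n)) :
    mollify n τ s α g x = (𝓕⁻ fun η : EuclideanSpace ℝ (Fin n) =>
      (molSymb τ s α η : ℂ) * (𝓕 g : L2 n) η) x := by
  set ψ : EuclideanSpace ℝ (Fin n) → ℂ := fun η =>
    Complex.exp (-((2 * Real.pi * inner ℝ η x : ℝ) * Complex.I)) * (molSymb τ s α η : ℂ) with hψ
  have hexp : ∀ η, ‖Complex.exp (-((2 * Real.pi * inner ℝ η x : ℝ) * Complex.I))‖ = 1 := by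
    intro η
    rw [← neg_mul, ← Complex.ofReal_neg, Complex.norm_exp_ofReal_mul_I]
  have hcont : Continuous fun η : EuclideanSpace ℝ (Fin n) =>
      Complex.exp (-((2 * Real.pi * inner ℝ η x : ℝ) * Complex.I)) := by fun_prop
  have hψm : AEStronglyMeasurable ψ volume :=
    (hcont.mul (Complex.continuous_ofReal.comp (continuous_molSymb hs α))).aestronglyMeasurable
  have hψn : ∀ η, ‖ψ η‖ = ‖(molSymb τ s α η : ℂ)‖ := fun η => by
    rw [hψ, norm_mul, hexp, one_mul]
  have hψ1 : Integrable ψ :=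
    (integrable_molSymb hτ hs hα).ofReal.congr' hψm (ae_of_all _ fun η => (hψn η).symm)
  have hψ2 : MemLp ψ 2 volume :=
    (memLp_molSymb hτ hs hα).congr_norm hψm (ae_of_all _ fun η => (hψn η).symm)
  have hF := fourierInv_ae_eq hψ1 hψ2.coeFn_toLp
  have hFψ : ∀ y, (starRingEnd ℂ) ((𝓕⁻ ψ : EuclideanSpace ℝ (Fin n) → ℂ) y) =
      scaledKernel n τ s α (x - y) := by
    intro y
    rw [scaledKernel_eq_fourierInv hα, Real.fourierInv_eq', Real.fourierInv_eq', ← integral_conj]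
    refine integral_congr_ae (ae_of_all _ fun η => ?_)
    simp only [hψ, smul_eq_mul, map_mul, ← Complex.exp_conj, Complex.conj_ofReal, Complex.conj_I,
      map_neg, inner_sub_right]
    rw [← mul_assoc, ← Complex.exp_add]
    congr 2
    push_cast
    ring
  have hinner : inner ℂ (𝓕⁻ hψ2.toLp : L2 n) g = inner ℂ (hψ2.toLp) (𝓕 g : L2 n) := by
    rw [← Lp.inner_fourier_eq, FourierTransform.fourier_fourierInv_eq]
  rw [L2.inner_def, L2.inner_def] at hinner
  have hL : ∫ y, inner ℂ ((𝓕⁻ hψ2.toLp : L2 n) y) (g y) = mollify n τ s α g x := by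
    refine integral_congr_ae ?_
    filter_upwards [hF] with y hy
    rw [hy, RCLike.inner_apply, hFψ, mul_comm]
  rw [← hL, hinner, Real.fourierInv_eq']
  refine integral_congr_ae ?_
  filter_upwards [hψ2.coeFn_toLp] with η hη
  rw [hη, RCLike.inner_apply]
  simp only [hψ, smul_eq_mul, map_mul, ← Complex.exp_conj, Complex.conj_ofReal, Complex.conj_I,
    map_neg, mul_neg, neg_neg]
  ring

theorem mollify_ae_eq {τ s α : ℝ} (hτ : 0 < τ) (hs : 0 < s) (hα : 0 < α) (g : L2 n) :
    mollify n τ s α g =ᵐ[volume] (𝓕⁻ (mulOp (molSymb τ s α) (𝓕 g : L2 n)) : L2 n) := by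
  have hint : Integrable fun η : EuclideanSpace ℝ (Fin n) =>
      (molSymb τ s α η : ℂ) * (𝓕 g : L2 n) η :=
    (memLp_molSymb hτ hs hα).integrable_mul (Lp.memLp _)
  filter_upwards [fourierInv_ae_eq hint (coeFn_mulOp (isMultiplier_molSymb hτ hs hα.le) (𝓕 g))]
    with x hx
  rw [mollify_eq_fourierInv hτ hs hα, hx]

/-! ### Stability of the Caputo derivative under linear operations -/

theorem intervalIntegrable_congr_Ioo {E : Type*} [NormedAddCommGroup E] {f g : ℝ → E} {a b : ℝ}
    (hab : a ≤ b) (h : EqOn f g (Ioo a b)) (hf : IntervalIntegrable f volume a b) :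
    IntervalIntegrable g volume a b := by
  rw [intervalIntegrable_iff_integrableOn_Ioo_of_le hab] at hf ⊢
  exact hf.congr_fun h measurableSet_Ioo

section Caputo

variable {E F : Type*} [NormedAddCommGroup E] [NormedSpace ℝ E] [NormedAddCommGroup F]
  [NormedSpace ℝ F] {γ t : ℝ}

theorem intervalIntegral_congr_Ioo {f g : ℝ → E} {a b : ℝ} (hab : a ≤ b)
    (h : EqOn f g (Ioo a b)) : ∫ r in a..b, f r = ∫ r in a..b, g r := by
  rw [intervalIntegral.integral_of_le hab, intervalIntegral.integral_of_le hab,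
    ← restrict_Ioo_eq_restrict_Ioc]
  exact setIntegral_congr_fun measurableSet_Ioo h

theorem HasCaputoDerivAt.clm_comp [CompleteSpace E] [CompleteSpace F] {u : ℝ → E} {D : E}
    (h : HasCaputoDerivAt γ u D t) (ht : 0 < t) (L : E →L[ℝ] F) :
    HasCaputoDerivAt γ (fun r => L (u r)) (L D) t := by
  obtain ⟨hd, hi, hl⟩ := h
  have hder : ∀ r ∈ Ioo 0 t, HasDerivAt (fun r => L (u r)) (L (deriv u r)) r := fun r hr =>
    L.hasFDerivAt.comp_hasDerivAt r (hd r hr).hasDerivAt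
  have heq : ∀ ε ∈ Ioo 0 t, EqOn (fun r => L ((t - r) ^ (-γ) • deriv u r))
      (fun r => (t - r) ^ (-γ) • deriv (fun r => L (u r)) r) (Ioo ε t) := fun ε hε r hr => by
    simp only [(hder r ⟨hε.1.trans hr.1, hr.2⟩).deriv, map_smul]
  refine ⟨fun r hr => (hder r hr).differentiableAt, fun ε hε => ?_, ?_⟩
  · refine intervalIntegrable_congr_Ioo hε.2.le (heq ε hε) ?_
    exact ⟨L.integrable_comp (hi ε hε).1, L.integrable_comp (hi ε hε).2⟩
  · refine ((L.continuous.tendsto _).comp hl).congr' ?_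
    filter_upwards [Ioo_mem_nhdsGT ht] with ε hε
    rw [Function.comp_apply, map_smul, ← L.intervalIntegral_comp_comm (hi ε hε),
      intervalIntegral_congr_Ioo hε.2.le (heq ε hε)]

theorem HasCaputoDerivAt.sub {u v : ℝ → E} {D D' : E} (hu : HasCaputoDerivAt γ u D t)
    (hv : HasCaputoDerivAt γ v D' t) (ht : 0 < t) :
    HasCaputoDerivAt γ (fun r => u r - v r) (D - D') t := by
  have heq : ∀ ε ∈ Ioo 0 t, EqOn
      (fun r => (t - r) ^ (-γ) • deriv u r - (t - r) ^ (-γ) • deriv v r)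
      (fun r => (t - r) ^ (-γ) • deriv (fun r => u r - v r) r) (Ioo ε t) := fun ε hε r hr => by
    have hr' : r ∈ Ioo 0 t := ⟨hε.1.trans hr.1, hr.2⟩
    simp only [((hu.1 r hr').hasDerivAt.fun_sub (hv.1 r hr').hasDerivAt).deriv, smul_sub]
  refine ⟨fun r hr => (hu.1 r hr).sub (hv.1 r hr), fun ε hε =>
    intervalIntegrable_congr_Ioo hε.2.le (heq ε hε) ((hu.2.1 ε hε).sub (hv.2.1 ε hε)), ?_⟩
  refine (hu.2.2.sub hv.2.2).congr' ?_
  filter_upwards [Ioo_mem_nhdsGT ht] with ε hε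
  rw [← smul_sub, ← intervalIntegral.integral_sub (hu.2.1 ε hε) (hv.2.1 ε hε),
    intervalIntegral_congr_Ioo hε.2.le (heq ε hε)]

end Caputo

/-! ### Representation of weak solutions -/

/-- The Fourier transform on `L²` as a continuous linear map. -/
def fourierL2 (n : ℕ) : L2 n →L[ℂ] L2 n := FourierTransform.fourierCLM ℂ (L2 n)

/-- The inverse Fourier transform on `L²` as a continuous linear map. -/
def fourierInvL2 (n : ℕ) : L2 n →L[ℂ] L2 n := FourierTransform.fourierInvCLM ℂ (L2 n)

theorem fourierInvL2_apply (f : L2 n) : fourierInvL2 n f = 𝓕⁻ f := rfl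

theorem norm_fourierInvL2_apply (f : L2 n) : ‖fourierInvL2 n f‖ = ‖f‖ := by
  rw [fourierInvL2_apply, ← Lp.norm_fourier_eq, FourierTransform.fourier_fourierInv_eq]

theorem mulOp_mulOp {m₁ m₂ m₃ m₄ : EuclideanSpace ℝ (Fin n) → ℝ} (h₁ : IsMultiplier m₁)
    (h₂ : IsMultiplier m₂) (h₃ : IsMultiplier m₃) (h₄ : IsMultiplier m₄)
    (h : ∀ η, m₁ η * m₂ η = m₃ η * m₄ η) (f : L2 n) :
    mulOp m₁ (mulOp m₂ f) = mulOp m₃ (mulOp m₄ f) := by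
  refine Lp.ext ?_
  filter_upwards [coeFn_mulOp h₁ (mulOp m₂ f), coeFn_mulOp h₃ (mulOp m₄ f), coeFn_mulOp h₂ f,
    coeFn_mulOp h₄ f] with η e₁ e₃ e₂ e₄
  rw [e₁, e₂, e₃, e₄, ← mul_assoc, ← mul_assoc, ← Complex.ofReal_mul, ← Complex.ofReal_mul, h]

/-- The indicator of the ball of radius `N`. -/
def cutoff (N : ℕ) (η : EuclideanSpace ℝ (Fin n)) : ℝ := if ‖η‖ ≤ N then 1 else 0

theorem measurable_cutoff (N : ℕ) : Measurable (cutoff (n := n) N) :=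
  Measurable.ite (measurableSet_le measurable_norm measurable_const) measurable_const
    measurable_const

theorem isMultiplier_cutoff (N : ℕ) : IsMultiplier (cutoff (n := n) N) :=
  ⟨measurable_cutoff N, 1, fun η => by unfold cutoff; split_ifs <;> simp⟩

theorem isMultiplier_symb_mul_cutoff (N : ℕ) :
    IsMultiplier fun η : EuclideanSpace ℝ (Fin n) => symb η * cutoff N η := by
  refine ⟨continuous_symb.measurable.mul (measurable_cutoff N), (2 * Real.pi * N) ^ 2,
    fun η => ?_⟩
  simp only [cutoff]
  split_ifs with h
  · rw [mul_one, abs_of_nonneg (symb_nonneg η), symb]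
    gcongr
  · simp only [mul_zero, abs_zero]
    positivity

/-- After a frequency cutoff, `-symb` is a bounded multiplier, so the uniqueness theorem identifies
the truncated transform with the explicit evolution. Every frequency lies in some ball, and
countably many balls suffice almost everywhere. -/
theorem IsWeakSolution.fourier_eq {γ T : ℝ} (hγ : γ ∈ Ioo (0 : ℝ) 1) (hT : 0 < T)
    {g : EuclideanSpace ℝ (Fin n) → ℂ} {v : ℝ → L2 n} (hv : IsWeakSolution n γ T g v) {t : ℝ}
    (ht : t ∈ Icc 0 T) : (𝓕 (v t) : L2 n) = relaxOp n γ t (𝓕 (v 0)) := by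
  have hcut : ∀ N : ℕ, mulOp (cutoff N) (𝓕 (v t) : L2 n) =
      relaxOp n γ t (mulOp (cutoff N) (𝓕 (v 0))) := by
    intro N
    set P : L2 n →L[ℂ] L2 n := mulOp (cutoff N) with hP
    set B : L2 n →L[ℂ] L2 n := mulOp fun η => symb η * cutoff N η with hB
    set L : L2 n →L[ℝ] L2 n := (P ∘L fourierL2 n).restrictScalars ℝ with hL
    set f₀ : L2 n := P (𝓕 (v 0)) with hf₀
    have hBf₀ : B f₀ =ᵐ[volume] fun η => (symb η : ℂ) * f₀ η := by
      filter_upwards [coeFn_mulOp (isMultiplier_symb_mul_cutoff N) f₀,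
        coeFn_mulOp (isMultiplier_cutoff N) (𝓕 (v 0) : L2 n)] with η h1 h2
      rw [hB, h1, hf₀, hP, h2, cutoff]
      split_ifs <;> simp
    have hz := eq_zero_of_caputo_linear hγ hT (y := fun r => L (v r) - relaxOp n γ r f₀)
      ((-B).restrictScalars ℝ)
      ((L.continuous.comp_continuousOn hv.continuousOn_L2).sub
        ((continuousOn_relaxOp hγ f₀).mono Icc_subset_Ici_self))
      (by simp only [relaxOp_zero hγ]; exact sub_self _) ?_ t ht
    · exact sub_eq_zero.1 hz
    · intro r hr
      obtain ⟨D, hD, hDΔ⟩ := hv.equation r hr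
      have h1 := hD.clm_comp hr.1 L
      have h2 := hasCaputoDerivAt_relaxOp hγ hr.1 hBf₀
      have h3 : L D = -B (L (v r)) := by
        refine Lp.ext ?_
        filter_upwards [(eq_laplacian_iff (v r) D).1 hDΔ,
          coeFn_mulOp (isMultiplier_cutoff N) (𝓕 D : L2 n),
          coeFn_mulOp (isMultiplier_cutoff N) (𝓕 (v r) : L2 n),
          coeFn_mulOp (isMultiplier_symb_mul_cutoff N) (L (v r)),
          Lp.coeFn_neg (B (L (v r)))] with η e1 e2 e3 e4 e5
        rw [e5, Pi.neg_apply, hB, e4]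
        change (mulOp (cutoff N) (𝓕 D : L2 n)) η =
          -(((symb η * cutoff N η : ℝ) : ℂ) * (mulOp (cutoff N) (𝓕 (v r) : L2 n)) η)
        rw [e2, e3, e1, cutoff]
        split_ifs <;> simp
      have h4 : relaxOp n γ r (B f₀) = B (relaxOp n γ r f₀) :=
        mulOp_mulOp (isMultiplier_relax hγ hr.1.le) (isMultiplier_symb_mul_cutoff N)
          (isMultiplier_symb_mul_cutoff N) (isMultiplier_relax hγ hr.1.le)
          (fun η => mul_comm _ _) f₀
      have h5 := h1.sub h2 hr.1
      rw [h3, h4] at h5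
      convert h5 using 1
      simp only [ContinuousLinearMap.coe_restrictScalars', neg_apply, map_sub]
  refine Lp.ext ?_
  have hae : ∀ᵐ η, ∀ N : ℕ, (cutoff N η : ℂ) * (𝓕 (v t) : L2 n) η =
      (relax γ (symb η) t : ℂ) * ((cutoff N η : ℂ) * (𝓕 (v 0) : L2 n) η) := by
    refine ae_all_iff.2 fun N => ?_
    have h := hcut N
    filter_upwards [coeFn_mulOp (isMultiplier_cutoff N) (𝓕 (v t) : L2 n),
      coeFn_mulOp (isMultiplier_cutoff N) (𝓕 (v 0) : L2 n),
      coeFn_mulOp (isMultiplier_relax hγ ht.1) (mulOp (cutoff N) (𝓕 (v 0) : L2 n))]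
      with η e1 e2 e3
    rw [← e1, h, relaxOp, e3, e2]
  filter_upwards [hae, coeFn_mulOp (isMultiplier_relax hγ ht.1) (𝓕 (v 0) : L2 n)] with η h1 h2
  obtain ⟨N, hN⟩ := exists_nat_ge ‖η‖
  have := h1 N
  simp only [cutoff, if_pos hN, Complex.ofReal_one, one_mul] at this
  rw [this, relaxOp, h2]

/-! ### The regularized solution operators -/

/-- The symbol taking `ĝ` to the Fourier transform of the initial value of the solution with
final data `M_α g`. -/
def initSymb (γ T τ s α : ℝ) (η : EuclideanSpace ℝ (Fin n)) : ℝ :=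
  molSymb τ s α η / relax γ (symb η) T

/-- The regularized solution operator `g ↦ u_α(·, t)`. -/
def solOp (n : ℕ) (γ T τ s α t : ℝ) : L2 n →L[ℂ] L2 n :=
  fourierInvL2 n ∘L relaxOp n γ t ∘L mulOp (initSymb γ T τ s α) ∘L fourierL2 n

theorem initSymb_nonneg {γ T τ s : ℝ} (hγ : γ ∈ Ioo (0 : ℝ) 1) (hT : 0 < T) (α : ℝ)
    (η : EuclideanSpace ℝ (Fin n)) : 0 ≤ initSymb γ T τ s α η :=
  div_nonneg (molSymb_pos _ _ _ _).le (relax_pos hγ (symb_nonneg η) hT.le).le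

theorem initSymb_le {γ T τ s : ℝ} (hγ : γ ∈ Ioo (0 : ℝ) 1) (hT : 0 < T) (α : ℝ)
    (η : EuclideanSpace ℝ (Fin n)) :
    initSymb γ T τ s α η ≤ (1 + Real.Gamma (1 - γ) * T ^ γ * symb η) * molSymb τ s α η := by
  have h := one_le_relax_mul hγ (symb_nonneg η) hT.le
  have hp := relax_pos hγ (symb_nonneg η) hT.le
  rw [initSymb, div_le_iff₀ hp]
  have := mul_le_mul_of_nonneg_left h (molSymb_pos τ s α η).le
  linarith

theorem measurable_initSymb {γ τ s : ℝ} (hγ : 0 < γ) (hs : 0 < s) (T α : ℝ) :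
    Measurable (initSymb (n := n) γ T τ s α) :=
  (continuous_molSymb hs α).measurable.div (measurable_relax_symb hγ T)

theorem exists_initSymb_le {γ T τ s : ℝ} (hγ : γ ∈ Ioo (0 : ℝ) 1) (hT : 0 < T)
    (hτ : 0 < τ) (hs : 0 < s) :
    ∃ C > 0, ∀ α ∈ Ioo (0 : ℝ) 1, ∀ η : EuclideanSpace ℝ (Fin n),
      initSymb γ T τ s α η ≤ C / α ^ 2 := by
  obtain ⟨C, hC, h⟩ := one_add_rpow_mul_exp_le (p := 2) zero_le_two hτ hs
  have hG : 0 < Real.Gamma (1 - γ) := Real.Gamma_pos_of_pos (sub_pos.2 hγ.2)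
  set κ := Real.Gamma (1 - γ) * T ^ γ with hκ
  have hκ0 : 0 < κ := by positivity
  refine ⟨(1 + κ) * C, by positivity, fun α hα η => ?_⟩
  have hα0 := hα.1
  refine (initSymb_le hγ hT α η).trans ?_
  rw [← hκ, le_div_iff₀ (by positivity)]
  set x := α * (2 * Real.pi * ‖η‖) with hx
  have hx0 : 0 ≤ x := by positivity
  have h1 := h x hx0
  rw [Real.rpow_two] at h1
  have h2 : α ^ 2 * symb η = x ^ 2 := by rw [symb, hx]; ring
  have h3 : α ^ 2 ≤ 1 := pow_le_one₀ hα0.le hα.2.le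
  -- The factor `α²` turns `|ξ|²` into `x²`, while the constant term needs `α ≤ 1`; hence the
  -- threshold `α₀ = 1`.
  have h4 : (1 + κ * symb η) * α ^ 2 ≤ (1 + κ) * (1 + x) ^ 2 := by
    have : (1 + κ * symb η) * α ^ 2 = α ^ 2 + κ * x ^ 2 := by rw [← h2]; ring
    rw [this]
    nlinarith [mul_nonneg hκ0.le hx0, sq_nonneg x]
  calc (1 + κ * symb η) * molSymb τ s α η * α ^ 2
      = (1 + κ * symb η) * α ^ 2 * Real.exp (-(τ * x ^ s)) := by rw [molSymb]; ring
    _ ≤ (1 + κ) * (1 + x) ^ 2 * Real.exp (-(τ * x ^ s)) := by gcongr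
    _ = (1 + κ) * ((1 + x) ^ 2 * Real.exp (-(τ * x ^ s))) := by ring
    _ ≤ (1 + κ) * C := by gcongr

theorem isMultiplier_weight_mul_initSymb {γ T τ s : ℝ} (hγ : γ ∈ Ioo (0 : ℝ) 1) (hT : 0 < T)
    (hτ : 0 < τ) (hs : 0 < s) {α : ℝ} (hα : 0 < α)
    {w : EuclideanSpace ℝ (Fin n) → ℝ} (hw : Measurable w) (hw0 : ∀ η, 0 ≤ w η)
    (hw1 : ∀ η, w η ≤ 1 + symb η) :
    IsMultiplier fun η => w η * initSymb γ T τ s α η := by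
  -- The exponent `4` splits as `2` for the weight `w` and `2` for the division by `relax`.
  obtain ⟨C, hC, h⟩ := one_add_norm_rpow_mul_molSymb_le (n := n) (p := 4) hτ hs hα (by norm_num)
  have hG : 0 < Real.Gamma (1 - γ) := Real.Gamma_pos_of_pos (sub_pos.2 hγ.2)
  set κ := Real.Gamma (1 - γ) * T ^ γ with hκ
  have hκ0 : 0 < κ := by positivity
  set c := (2 * Real.pi) ^ 2 with hc
  have hc0 : 0 < c := by positivity
  refine ⟨hw.mul (measurable_initSymb hγ.1 hs T α), (1 + c) * (1 + κ * c) * C, fun η => ?_⟩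
  rw [abs_of_nonneg (mul_nonneg (hw0 η) (initSymb_nonneg hγ hT α η))]
  have h4 := h η
  rw [show (4 : ℝ) = ((4 : ℕ) : ℝ) by norm_num, Real.rpow_natCast] at h4
  have hb : ∀ k : ℝ, 0 ≤ k → 1 + k * symb η ≤ (1 + k * c) * (1 + ‖η‖) ^ 2 := fun k hk => by
    have h5 : symb η = c * ‖η‖ ^ 2 := by rw [symb, hc]; ring
    rw [h5]
    have := norm_nonneg η
    have h6 : 0 ≤ k * c := by positivity
    nlinarith [mul_nonneg h6 this]
  have hm := molSymb_pos τ s α η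
  have hs0 := symb_nonneg η
  calc w η * initSymb γ T τ s α η
      ≤ (1 + 1 * symb η) * ((1 + κ * symb η) * molSymb τ s α η) :=
        mul_le_mul (by simpa using hw1 η) (initSymb_le hγ hT α η)
          (initSymb_nonneg hγ hT α η) (by positivity)
    _ ≤ ((1 + 1 * c) * (1 + ‖η‖) ^ 2) * (((1 + κ * c) * (1 + ‖η‖) ^ 2) * molSymb τ s α η) := by
        gcongr
        · exact hb 1 zero_le_one
        · exact hb κ hκ0.le
    _ = (1 + c) * (1 + κ * c) * ((1 + ‖η‖) ^ 4 * molSymb τ s α η) := by ring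
    _ ≤ _ := by gcongr

theorem isMultiplier_initSymb {γ T τ s : ℝ} (hγ : γ ∈ Ioo (0 : ℝ) 1) (hT : 0 < T)
    (hτ : 0 < τ) (hs : 0 < s) {α : ℝ} (hα : 0 < α) :
    IsMultiplier (initSymb (n := n) γ T τ s α) := by
  simpa using isMultiplier_weight_mul_initSymb (n := n) hγ hT hτ hs hα (w := fun _ => 1)
    measurable_const (fun _ => zero_le_one) fun η => by linarith [symb_nonneg η]

/-- For a weight `w ≤ 1 + symb`, multiplication by `w` after the evolution is evolution after
multiplication by `w`. -/
theorem relaxOp_weight_ae {γ T τ s : ℝ} (hγ : γ ∈ Ioo (0 : ℝ) 1) (hT : 0 < T)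
    (hτ : 0 < τ) (hs : 0 < s) {α : ℝ} (hα : 0 < α) {w : EuclideanSpace ℝ (Fin n) → ℝ}
    (hw : Measurable w) (hw0 : ∀ η, 0 ≤ w η) (hw1 : ∀ η, w η ≤ 1 + symb η) {t : ℝ} (ht : 0 ≤ t)
    (f : L2 n) :
    relaxOp n γ t (mulOp (fun η => w η * initSymb γ T τ s α η) f) =ᵐ[volume]
      fun η => (w η : ℂ) * relaxOp n γ t (mulOp (initSymb γ T τ s α) f) η := by
  have hm := isMultiplier_weight_mul_initSymb hγ hT hτ hs hα hw hw0 hw1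
  have hq := isMultiplier_initSymb (n := n) hγ hT hτ hs hα
  filter_upwards [coeFn_mulOp hm f, coeFn_mulOp hq f,
    coeFn_mulOp (isMultiplier_relax hγ ht) (mulOp (fun η => w η * initSymb γ T τ s α η) f),
    coeFn_mulOp (isMultiplier_relax hγ ht) (mulOp (initSymb γ T τ s α) f)] with η h1 h2 h3 h4
  rw [relaxOp, h3, h4, h1, h2]
  push_cast
  ring

theorem norm_solOp_le {γ T τ s : ℝ} (hγ : γ ∈ Ioo (0 : ℝ) 1) (hT : 0 < T)
    (hτ : 0 < τ) (hs : 0 < s) {α t C : ℝ} (hα : 0 < α) (ht : 0 ≤ t)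
    (hC : ∀ η : EuclideanSpace ℝ (Fin n), initSymb γ T τ s α η ≤ C) :
    ‖solOp n γ T τ s α t‖ ≤ C := by
  have hq := isMultiplier_initSymb (n := n) hγ hT hτ hs hα
  have hq0 := initSymb_nonneg (n := n) (τ := τ) (s := s) hγ hT α
  have hC0 : 0 ≤ C := (hq0 0).trans (hC 0)
  refine ContinuousLinearMap.opNorm_le_bound _ hC0 fun g => ?_
  have h1 := norm_mulOp_apply_le (isMultiplier_relax (n := n) hγ ht)
    (fun η => abs_relax_le_one hγ (symb_nonneg η) ht) (mulOp (initSymb γ T τ s α) (𝓕 g : L2 n))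
  have h2 := norm_mulOp_apply_le hq (C := C)
    (fun η => by rw [abs_of_nonneg (hq0 η)]; exact hC η) (𝓕 g : L2 n)
  rw [Lp.norm_fourier_eq] at h2
  rw [one_mul] at h1
  calc ‖solOp n γ T τ s α t g‖
      = ‖relaxOp n γ t (mulOp (initSymb γ T τ s α) (𝓕 g : L2 n))‖ := norm_fourierInvL2_apply _
    _ ≤ _ := h1.trans h2

/-- For data that come from a solution, the growing factor `1 / relax` cancels and only the
mollifier remains. -/
theorem mulOp_initSymb_relaxOp {γ T τ s : ℝ} (hγ : γ ∈ Ioo (0 : ℝ) 1) (hT : 0 < T)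
    (hτ : 0 < τ) (hs : 0 < s) {α : ℝ} (hα : 0 < α) (f : L2 n) :
    mulOp (initSymb γ T τ s α) (relaxOp n γ T f) = mulOp (molSymb τ s α) f := by
  refine Lp.ext ?_
  filter_upwards [coeFn_mulOp (isMultiplier_initSymb hγ hT hτ hs hα) (relaxOp n γ T f),
    coeFn_mulOp (isMultiplier_relax hγ hT.le) f,
    coeFn_mulOp (isMultiplier_molSymb hτ hs hα.le) f] with η h1 h2 h3
  have h0 : (relax γ (symb η) T : ℂ) ≠ 0 :=
    Complex.ofReal_ne_zero.2 (relax_pos hγ (symb_nonneg η) hT.le).ne'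
  rw [h1, relaxOp, h2, h3, initSymb]
  push_cast
  field_simp

theorem relaxOp_mulOp_initSymb {γ T τ s : ℝ} (hγ : γ ∈ Ioo (0 : ℝ) 1) (hT : 0 < T)
    (hτ : 0 < τ) (hs : 0 < s) {α : ℝ} (hα : 0 < α) (f : L2 n) :
    relaxOp n γ T (mulOp (initSymb γ T τ s α) f) = mulOp (molSymb τ s α) f := by
  rw [← mulOp_initSymb_relaxOp hγ hT hτ hs hα]
  exact mulOp_mulOp (isMultiplier_relax hγ hT.le) (isMultiplier_initSymb hγ hT hτ hs hα)
    (isMultiplier_initSymb hγ hT hτ hs hα) (isMultiplier_relax hγ hT.le)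
    (fun η => mul_comm _ _) f

theorem eq_of_ae_eq_mollify {τ s : ℝ} (hτ : 0 < τ) (hs : 0 < s) {α : ℝ} (hα : 0 < α) {g v : L2 n}
    (h : v =ᵐ[volume] mollify n τ s α g) : (𝓕 v : L2 n) = mulOp (molSymb τ s α) (𝓕 g) := by
  have : v = (𝓕⁻ (mulOp (molSymb τ s α) (𝓕 g : L2 n)) : L2 n) :=
    Lp.ext (h.trans (mollify_ae_eq hτ hs hα g))
  rw [this, FourierTransform.fourier_fourierInv_eq]

theorem isWeakSolution_solOp {γ T τ s : ℝ} (hγ : γ ∈ Ioo (0 : ℝ) 1) (hT : 0 < T)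
    (hτ : 0 < τ) (hs : 0 < s) {α : ℝ} (hα : 0 < α) (g : L2 n) :
    IsWeakSolution n γ T (mollify n τ s α g) (fun t => solOp n γ T τ s α t g) := by
  set F : L2 n := mulOp (initSymb γ T τ s α) (𝓕 g : L2 n) with hF
  have hsol : ∀ t, solOp n γ T τ s α t g = fourierInvL2 n (relaxOp n γ t F) := fun _ => rfl
  have hfour : ∀ t, (𝓕 (solOp n γ T τ s α t g) : L2 n) = relaxOp n γ t F := fun t => by
    rw [hsol, fourierInvL2_apply, FourierTransform.fourier_fourierInv_eq]
  constructor
  · exact (fourierInvL2 n).continuous.comp_continuousOn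
      ((continuousOn_relaxOp hγ F).mono Icc_subset_Ici_self)
  · intro t ht
    refine memSobolev_two_of_ae_eq
      (v := relaxOp n γ t (mulOp (fun η => (1 + ‖η‖ ^ 2) * initSymb γ T τ s α η) (𝓕 g))) ?_
    rw [hfour]
    refine relaxOp_weight_ae hγ hT hτ hs hα (by fun_prop) (fun η => by positivity)
      (fun η => ?_) ht.1.le _
    rw [symb]
    -- `MemSobolev` uses the weight `1 + ‖η‖²` without the factor `2π`; it is dominated by `1 +
    -- symb`.
    have : 1 ≤ 2 * Real.pi := by linarith [Real.two_le_pi]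
    gcongr
    nlinarith [norm_nonneg η]
  · intro t ht
    -- The weight in `sobolevNorm` for `p = 2` is `1 + symb`, so continuity in `H²` is `L²`
    -- continuity of the evolution of `W`.
    set W : L2 n := mulOp (fun η => (1 + symb η) * initSymb γ T τ s α η) (𝓕 g) with hW
    have hWae : ∀ r, 0 ≤ r → relaxOp n γ r W =ᵐ[volume]
        fun η => ((1 + symb η : ℝ) : ℂ) * relaxOp n γ r F η := fun r hr =>
      relaxOp_weight_ae hγ hT hτ hs hα (measurable_const.add continuous_symb.measurable)
        (fun η => add_nonneg zero_le_one (symb_nonneg η)) (fun η => le_rfl) hr _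
    have hcont : Tendsto (fun r => relaxOp n γ r W) (𝓝[Ioc 0 T] t) (𝓝 (relaxOp n γ t W)) :=
      (continuousOn_relaxOp hγ W t ht.1.le).mono (fun r hr => hr.1.le)
    rw [Lp.tendsto_Lp_iff_tendsto_eLpNorm'] at hcont
    refine hcont.congr' ?_
    filter_upwards [self_mem_nhdsWithin] with r hr
    rw [sobolevNorm]
    refine eLpNorm_congr_ae ?_
    have hsub : (𝓕 (solOp n γ T τ s α r g - solOp n γ T τ s α t g) : L2 n) =
        relaxOp n γ r F - relaxOp n γ t F := by
      rw [← hfour, ← hfour]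
      exact map_sub (fourierL2 n) _ _
    rw [hsub]
    filter_upwards [hWae r hr.1.le, hWae t ht.1.le,
      Lp.coeFn_sub (relaxOp n γ r F) (relaxOp n γ t F)] with η h1 h2 h3
    rw [Pi.sub_apply, h1, h2, h3, Pi.sub_apply, div_self two_ne_zero, Real.rpow_one, ← mul_sub]
    rfl
  · intro t ht
    set G : L2 n := mulOp (fun η => symb η * initSymb γ T τ s α η) (𝓕 g) with hG
    have hw1 : ∀ η : EuclideanSpace ℝ (Fin n), symb η ≤ 1 + symb η := fun η => by linarith
    have hFG : G =ᵐ[volume] fun η => (symb η : ℂ) * F η := by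
      filter_upwards [coeFn_mulOp (isMultiplier_weight_mul_initSymb hγ hT hτ hs hα
        continuous_symb.measurable symb_nonneg hw1) (𝓕 g : L2 n),
        coeFn_mulOp (isMultiplier_initSymb hγ hT hτ hs hα) (𝓕 g : L2 n)] with η h1 h2
      rw [hG, h1, hF, h2]
      push_cast
      ring
    refine ⟨fourierInvL2 n (-relaxOp n γ t G), ?_, ?_⟩
    · exact (hasCaputoDerivAt_relaxOp hγ ht.1 hFG).clm_comp ht.1
        ((fourierInvL2 n).restrictScalars ℝ)
    · rw [eq_laplacian_iff, hfour, fourierInvL2_apply, FourierTransform.fourier_fourierInv_eq]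
      filter_upwards [Lp.coeFn_neg (relaxOp n γ t G), relaxOp_weight_ae hγ hT hτ hs hα
        continuous_symb.measurable symb_nonneg hw1 ht.1.le (𝓕 g : L2 n)] with η h1 h2
      rw [h1, Pi.neg_apply, hG, h2]
      push_cast
      ring
  · have h : solOp n γ T τ s α T g = (𝓕⁻ (mulOp (molSymb τ s α) (𝓕 g : L2 n)) : L2 n) := by
      rw [← relaxOp_mulOp_initSymb hγ hT hτ hs hα]
      rfl
    simp only [h]
    exact (mollify_ae_eq hτ hs hα g).symm

theorem IsWeakSolution.eq_solOp {γ T τ s : ℝ} (hγ : γ ∈ Ioo (0 : ℝ) 1) (hT : 0 < T)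
    (hτ : 0 < τ) (hs : 0 < s) {α : ℝ} (hα : 0 < α) {g : L2 n} {v : ℝ → L2 n}
    (hv : IsWeakSolution n γ T (mollify n τ s α g) v) {t : ℝ} (ht : t ∈ Icc 0 T) :
    v t = solOp n γ T τ s α t g := by
  have h1 := hv.fourier_eq hγ hT ht
  have h2 := hv.fourier_eq hγ hT (right_mem_Icc.2 hT.le)
  rw [eq_of_ae_eq_mollify hτ hs hα hv.final_value] at h2
  have h3 : (𝓕 (v 0) : L2 n) = mulOp (initSymb γ T τ s α) (𝓕 g : L2 n) := by
    refine Lp.ext ?_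
    filter_upwards [coeFn_mulOp (isMultiplier_relax hγ hT.le) (𝓕 (v 0) : L2 n),
      coeFn_mulOp (isMultiplier_initSymb hγ hT hτ hs hα) (𝓕 g : L2 n),
      coeFn_mulOp (isMultiplier_molSymb hτ hs hα.le) (𝓕 g : L2 n)] with η e1 e2 e3
    have h0 : (relax γ (symb η) T : ℂ) ≠ 0 :=
      Complex.ofReal_ne_zero.2 (relax_pos hγ (symb_nonneg η) hT.le).ne'
    have e4 : (relax γ (symb η) T : ℂ) * (𝓕 (v 0) : L2 n) η =
        (molSymb τ s α η : ℂ) * (𝓕 g : L2 n) η := by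
      rw [← e1, ← e3, h2]
      rfl
    rw [e2, initSymb]
    push_cast
    rw [div_mul_eq_mul_div, eq_div_iff h0, ← e4, mul_comm]
  rw [← FourierTransform.fourierInv_fourier_eq (F := L2 n) (v t), h1, h3]
  rfl

theorem tendsto_solOp {γ T τ s : ℝ} (hγ : γ ∈ Ioo (0 : ℝ) 1) (hT : 0 < T)
    (hτ : 0 < τ) (hs : 0 < s) {g : L2 n} {u : ℝ → L2 n} (hu : IsWeakSolution n γ T g u) {t : ℝ}
    (ht : t ∈ Icc 0 T) :
    Tendsto (fun α => solOp n γ T τ s α t g) (𝓝[>] 0) (𝓝 (u t)) := by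
  have h1 := hu.fourier_eq hγ hT ht
  have h2 := hu.fourier_eq hγ hT (right_mem_Icc.2 hT.le)
  have h3 : u T = g := Lp.ext hu.final_value
  rw [h3] at h2
  have hone : mulOp (fun _ => (1 : ℝ)) (𝓕 (u 0) : L2 n) = 𝓕 (u 0) := by
    refine Lp.ext ?_
    filter_upwards [coeFn_mulOp ⟨measurable_const, 1, fun _ => abs_one.le⟩ (𝓕 (u 0) : L2 n)]
      with η h
    rw [h]
    simp
  have hlim : Tendsto (fun α => mulOp (molSymb τ s α) (𝓕 (u 0) : L2 n)) (𝓝[>] 0)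
      (𝓝 (mulOp (fun _ => (1 : ℝ)) (𝓕 (u 0) : L2 n))) := by
    refine tendsto_mulOp (C := 1) ?_ measurable_const (fun _ => by simp) (fun η => ?_) _
    · filter_upwards [self_mem_nhdsWithin] with α hα
      refine ⟨(continuous_molSymb hs α).measurable, fun η => ?_⟩
      rw [abs_of_pos (molSymb_pos _ _ _ _)]
      exact molSymb_le_one hτ (le_of_lt hα) η
    · have hc : Continuous fun α : ℝ => molSymb τ s α η := by
        unfold molSymb
        exact Real.continuous_exp.comp (continuous_const.mul
          ((Real.continuous_rpow_const hs.le).comp (by fun_prop))).neg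
      have h0 : molSymb τ s 0 η = 1 := by simp [molSymb, Real.zero_rpow hs.ne']
      have := hc.tendsto 0
      rw [h0] at this
      exact this.mono_left nhdsWithin_le_nhds
  rw [hone] at hlim
  have hlim2 := (((fourierInvL2 n).continuous.comp (relaxOp n γ t).continuous).tendsto _).comp hlim
  have hu : (fourierInvL2 n ∘ relaxOp n γ t) (𝓕 (u 0) : L2 n) = u t := by
    rw [Function.comp_apply, ← h1, fourierInvL2_apply, FourierTransform.fourierInv_fourier_eq]
  rw [hu] at hlim2
  refine hlim2.congr' ?_
  filter_upwards [self_mem_nhdsWithin] with α hα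
  -- Since `ĝ` is `relaxOp n γ T` applied to the transform of `u 0`, the regularized solution is the
  -- evolution of the mollified true initial value.
  have h4 := mulOp_initSymb_relaxOp hγ hT hτ hs hα (𝓕 (u 0) : L2 n)
  rw [← h2] at h4
  rw [Function.comp_apply, ← h4]
  rfl

end FracDiffusion

end

theorem mainTheorem7 (n : ℕ) (γ T τ s : ℝ) (hγ : γ ∈ Ioo (0 : ℝ) 1) (hT : 0 < T)
    (hτ : 0 < τ) (hs : 0 < s) :
    ∃ R : ℝ → ℝ → (FracDiffusion.L2 n →L[ℂ] FracDiffusion.L2 n),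
      -- `R α t` maps `g` to `u_α(·, t)`, with `u_α` the unique solution with final data `M_α g`
      (∀ α : ℝ, 0 < α → ∀ g : FracDiffusion.L2 n,
        FracDiffusion.IsWeakSolution n γ T (FracDiffusion.mollify n τ s α g)
          (fun t => R α t g) ∧
        ∀ v : ℝ → FracDiffusion.L2 n,
          FracDiffusion.IsWeakSolution n γ T (FracDiffusion.mollify n τ s α g) v →
          ∀ t ∈ Icc (0 : ℝ) T, v t = R α t g) ∧
      -- the operator norms are `O(1/α²)` as `α → 0`
      (∃ C > (0 : ℝ), ∃ α₀ > (0 : ℝ), ∀ α ∈ Ioo (0 : ℝ) α₀, ∀ t ∈ Icc (0 : ℝ) T,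
        ‖R α t‖ ≤ C / α ^ 2) ∧
      -- convergence to the exact solution
      (∀ (g : FracDiffusion.L2 n) (u : ℝ → FracDiffusion.L2 n),
        FracDiffusion.IsWeakSolution n γ T g u →
        ∀ t ∈ Icc (0 : ℝ) T, Tendsto (fun α => R α t g) (𝓝[>] 0) (𝓝 (u t))) := by
  refine ⟨fun α t => FracDiffusion.solOp n γ T τ s α t, fun α hα g => ⟨?_, fun v hv t ht => ?_⟩,
    ?_, fun g u hu t ht => ?_⟩
  · exact FracDiffusion.isWeakSolution_solOp hγ hT hτ hs hα g
  · exact hv.eq_solOp hγ hT hτ hs hα ht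
  · obtain ⟨C, hC, h⟩ := FracDiffusion.exists_initSymb_le (n := n) hγ hT hτ hs
    exact ⟨C, hC, 1, one_pos, fun α hα t ht =>
      FracDiffusion.norm_solOp_le hγ hT hτ hs hα.1 ht.1 (h α hα)⟩
  · exact FracDiffusion.tendsto_solOp hγ hT hτ hs hu ht
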